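/- Let $E$ be a countable set, $a,b\colon E\to\mathbb R$ with $\alpha_e:=b(e)-a(e)>0$ for all $e\in E$, and let $P_1\in\mathbb C^{d\times d}$ be Hermitian and invertible, $P_1=S^\star\operatorname{diag}(m_1,\dots,m_d)S$ with $S$ unitary and $m_k\in\mathbb R\setminus\{0\}$. All functions are $\mathbb C^d$-valued, $\oplus$ is the Hilbert space direct sum, $\mathrm L^2_{w}(0,1)$ is $\mathrm L^2(0,1)$ with squared norm $w\int_0^1|f|^2$, and derivatives are weak. Consider * $A$ on $\bigoplus_e\mathrm L^2(a(e),b(e))$, $A(\phi_e)_e=((P_1\phi_e)')_e$, with domain $\bigoplus_e\mathrm H^1_0(a(e),b(e))$ (that is, $\phi_e\in \mathrm H^1_0(a(e),b(e))$ for all $e$ and $(\phi_e')_e\in\bigoplus_e\mathrm L^2(a(e),b(e))$); * $\tilde A$, the operator $A$ in the case $a(e)=0$, $b(e)=1$ for all $e$; * $\hat A$ on $\bigoplus_e\mathrm L^2_{1/\alpha_e}(0,1)$, $\hat A(x_e)_e=((P_1x_e/\alpha_e)')_e$, with domain $\{x: x_e\in \mathrm H^1_0(0,1)\ \forall e,\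 ((x_e/\alpha_e)')_e\in\bigoplus_e\mathrm L^2_{1/\alpha_e}(0,1)\}$. A linear operator $H$ is dissipative if $\operatorname{Re}\langle Hx,x\rangle\le 0$ on $D(H)$, and maximal dissipative if moreover it has no proper dissipative linear extension. Put $\tilde{\mathcal G}_1=\ker(1-\tilde A^\star)$, $\tilde{\mathcal G}_2=\ker(1+\tilde A^\star)$, $\mathcal G_1=\ker(1-\hat A^\star)$, $\mathcal G_2=\ker(1+\hat A^\star)$. Let $[\partial P_1/\alpha]_\alpha f=(P_1f/\alpha)'$ be the operator in $\mathrm L^2_{1/\alpha}(0,1)$ with domain $\mathrm H^1(0,1)$, and $[\partial P_1]=[\partial P_1/1]_1$. Then the following holds. 1. $\tilde{\mathcal G}_1=\bigoplus_e\ker(1+[\partial P_1])$, $\tilde{\mathcal G}_2=\bigoplus_e\ker(1-[\partial P_1])$, $\mathcal G_1=\bigoplus_e\ker(1+[\partial P_1/\alpha_e]_{\alpha_e})$, $\mathcal G_2=\bigoplus_e\ker(1-[\partial P_1/\alpha_e]_{\alpha_e})$. 2. $D(\hat A^\star)=D(\hat A)\dotplus\mathcal G_1\dotplus\mathcal G_2$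 is a direct decomposition. With the corresponding projections $\pi_1,\pi_2$ onto $\mathcal G_1,\mathcal G_2$, the map $F=(F_1,F_2)=(\sqrt2\,\pi_1,\sqrt2\,\pi_2)$ is a boundary system for $\hat A$: it maps $D(\hat A^\star)$ linearly onto $\mathcal G_1\oplus\mathcal G_2$, and $\langle x,\hat A^\star y\rangle+\langle\hat A^\star x,y\rangle=\langle F_1x,F_1y\rangle-\langle F_2x,F_2y\rangle$ for all $x,y\in D(\hat A^\star)$. 3. The following maps are well defined and unitary: $\mathbf S_{a,b}\colon\bigoplus_e\mathrm L^2_{1/\alpha_e}(0,1)\to\bigoplus_e\mathrm L^2(a(e),b(e))$, $(\mathbf S_{a,b}g)_e=\frac1{\alpha_e}g_e\bigl(\frac{\cdot-a(e)}{\alpha_e}\bigr)$, and $\mathbf S_+\colon\mathcal G_1\to\tilde{\mathcal G}_1$, $\mathbf S_-\colon\mathcal G_2\to\tilde{\mathcal G}_2$, $$(\mathbf S_\pm\phi)_e=S^\star\operatorname{diag}\Bigl(\frac{c^\pm_{m_k/\alpha_e}}{\alpha_e^{1/2}c^\pm_{m_k}}\Bigr)_{k}S\,\phi_e\bigl(\tfrac{\cdot}{\alpha_e}\bigr),\qquad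 c^\pm_m=\Bigl(\mp\frac m2\bigl(e^{\mp2/m}-1\bigr)\Bigr)^{1/2},$$ where $\phi_e$ is extended to $\mathbb R$ as a solution of $\phi_e\pm\frac1{\alpha_e}P_1\phi_e'=0$. Moreover $\mathbf S_{a,b}^{-1}$ maps $D(A^\star)$ into $D(\hat A^\star)$. 4. Let $H$ be a linear operator with $A\subseteq H\subseteq-A^\star$. Then $-H$ is maximal dissipative if and only if there is a contraction $T\colon\tilde{\mathcal G}_2\to\tilde{\mathcal G}_1$ with $$D(H)=\{x\in D(A^\star):\ T\,\mathbf S_-F_2(\mathbf S_{a,b}^{-1}x)=\mathbf S_+F_1(\mathbf S_{a,b}^{-1}x)\},$$ and $H$ is maximal dissipative if and only if there is a contraction $T\colon\tilde{\mathcal G}_1\to\tilde{\mathcal G}_2$ with $$D(H)=\{x\in D(A^\star):\ T\,\mathbf S_+F_1(\mathbf S_{a,b}^{-1}x)=\mathbf S_-F_2(\mathbf S_{a,b}^{-1}x)\}.$$ -/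

import Mathlib

open MeasureTheory Set Filter
open scoped ENNReal ContDiff Matrix

namespace PHNetwork

section Abstract

variable {X : Type*} [NormedAddCommGroup X] [InnerProductSpace ℂ X]

/-- `H` is dissipative: `Re ⟨H x, x⟩ ≤ 0` on its domain. -/
def IsDissipative (H : X →ₗ.[ℂ] X) : Prop :=
  ∀ x : H.domain, (inner ℂ (H x) (x : X)).re ≤ 0

/-- `H` is maximal dissipative: it is dissipative and has no proper dissipative linear extension. -/
def IsMaximalDissipative (H : X →ₗ.[ℂ] X) : Prop :=
  IsDissipative H ∧ ∀ K : X →ₗ.[ℂ] X, IsDissipative K → H ≤ K → K = H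

variable [CompleteSpace X]

/-- `ker (1 - A⋆)`: the vectors `x ∈ D(A⋆)` with `A⋆ x = x`. -/
noncomputable def kerOneSubAdjoint (A : X →ₗ.[ℂ] X) : Submodule ℂ X :=
  A.adjoint.graph.comap (LinearMap.id.prod LinearMap.id)

/-- `ker (1 + A⋆)`: the vectors `x ∈ D(A⋆)` with `A⋆ x = -x`. -/
noncomputable def kerOneAddAdjoint (A : X →ₗ.[ℂ] X) : Submodule ℂ X :=
  A.adjoint.graph.comap (LinearMap.id.prod (-LinearMap.id))

/-- `F = (F₁, F₂)` is (with the standard symmetric form on `X × X` and the standard unitary form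
`⟨x, u⟩ - ⟨y, v⟩` on `ker (1 - A⋆) ⊕ ker (1 + A⋆)`) a boundary system for `A`.
The graph of `A⋆` is identified with the domain of `A⋆`. -/
def IsBoundarySystem (A : X →ₗ.[ℂ] X)
    (F : A.adjoint.domain →ₗ[ℂ] kerOneSubAdjoint A × kerOneAddAdjoint A) : Prop :=
  Function.Surjective F ∧
    ∀ x y : A.adjoint.domain,
      inner ℂ (x : X) (A.adjoint y) + inner ℂ (A.adjoint x) (y : X)
        = inner ℂ (F x).1 (F y).1 - inner ℂ (F x).2 (F y).2

/-- `F = (√2 P₁, √2 P₂)`, where `P₁, P₂` are the projections belonging to the direct decomposition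
`D(A⋆) = D(A) ∔ ker (1 - A⋆) ∔ ker (1 + A⋆)`. From right to left this is the existence of
the decomposition of `x`, from left to right its uniqueness. -/
def IsCanonicalBoundaryMap (A : X →ₗ.[ℂ] X)
    (F : A.adjoint.domain →ₗ[ℂ] kerOneSubAdjoint A × kerOneAddAdjoint A) : Prop :=
  ∀ (x : A.adjoint.domain) (g₁ : kerOneSubAdjoint A) (g₂ : kerOneAddAdjoint A),
    (x : X) - g₁ - g₂ ∈ A.domain ↔ F x = (((√2 : ℝ) : ℂ) • g₁, ((√2 : ℝ) : ℂ) • g₂)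

end Abstract

section Network

variable {d : ℕ}

/-- `g` is the weak derivative of `f` on the interval `(a, b)`. -/
def IsWeakDeriv (a b : ℝ) (f g : ℝ → EuclideanSpace ℂ (Fin d)) : Prop :=
  ∀ φ : ℝ → ℝ, ContDiff ℝ ∞ φ → HasCompactSupport φ → tsupport φ ⊆ Ioo a b →
    ∫ t in Ioo a b, deriv φ t • f t = - ∫ t in Ioo a b, φ t • g t

/-- `f` has on `(a, b)` a representative which is continuous on `[a, b]` and zero at `a` and `b`. -/
def VanishesAtEnds (a b : ℝ) (f : ℝ → EuclideanSpace ℂ (Fin d)) : Prop :=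
  ∃ u : ℝ → EuclideanSpace ℂ (Fin d), ContinuousOn u (Icc a b) ∧
    f =ᵐ[volume.restrict (Ioo a b)] u ∧ u a = 0 ∧ u b = 0

/-- Lebesgue measure on `(a, b)` with the constant weight `w`. -/
noncomputable def edgeMeasure (a b w : ℝ) : Measure ℝ :=
  ENNReal.ofReal w • volume.restrict (Ioo a b)

/-- The space `L²_w(a, b)` of `ℂᵈ`-valued functions, normed by `(∫ w ‖f‖²)^{1/2}`. -/
abbrev EdgeL2 (d : ℕ) (a b w : ℝ) : Type :=
  Lp (EuclideanSpace ℂ (Fin d)) 2 (edgeMeasure a b w)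

/-- The Hilbert space direct sum of the spaces `L²_{w e}(a e, b e)`. -/
abbrev NetL2 (d : ℕ) {E : Type*} (a b w : E → ℝ) : Type _ :=
  lp (fun e => EdgeL2 d (a e) (b e) (w e)) 2

theorem ae_edgeMeasure {a b w : ℝ} {p : ℝ → Prop} (h : ∀ᵐ t ∂volume.restrict (Ioo a b), p t) :
    ∀ᵐ t ∂edgeMeasure a b w, p t :=
  Measure.smul_absolutelyContinuous.ae_le h

theorem ae_of_ae_edgeMeasure {a b w : ℝ} (hw : 0 < w) {p : ℝ → Prop}
    (h : ∀ᵐ t ∂edgeMeasure a b w, p t) : ∀ᵐ t ∂volume.restrict (Ioo a b), p t :=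
  (Measure.absolutelyContinuous_smul (by simpa using hw)).ae_le h

theorem EdgeL2.integrableOn {a b w : ℝ} (hw : 0 < w) (f : EdgeL2 d a b w) :
    IntegrableOn f (Ioo a b) := by
  have h := Lp.memLp f
  have hw0 : ENNReal.ofReal w ≠ 0 := by simpa using hw
  have h2 : MemLp f 2 (volume.restrict (Ioo a b)) := by
    have h3 : MemLp f 2 ((ENNReal.ofReal w)⁻¹ • ENNReal.ofReal w • volume.restrict (Ioo a b)) :=
      h.smul_measure (ENNReal.inv_ne_top.2 hw0)
    rwa [smul_smul, ENNReal.inv_mul_cancel hw0 ENNReal.ofReal_ne_top, one_smul] at h3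
  exact h2.integrable (by norm_num)

theorem IsWeakDeriv.congr {a b : ℝ} {f f' g g' : ℝ → EuclideanSpace ℂ (Fin d)}
    (h : IsWeakDeriv a b f g) (hf : f' =ᵐ[volume.restrict (Ioo a b)] f)
    (hg : g' =ᵐ[volume.restrict (Ioo a b)] g) : IsWeakDeriv a b f' g' := by
  intro φ h1 h2 h3
  have e1 : ∫ t in Ioo a b, deriv φ t • f' t = ∫ t in Ioo a b, deriv φ t • f t :=
    integral_congr_ae (by filter_upwards [hf] with t ht; rw [ht])
  have e2 : ∫ t in Ioo a b, φ t • g' t = ∫ t in Ioo a b, φ t • g t :=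
    integral_congr_ae (by filter_upwards [hg] with t ht; rw [ht])
  rw [e1, e2]
  exact h φ h1 h2 h3

theorem integrableOn_test_smul {a b : ℝ} {f : ℝ → EuclideanSpace ℂ (Fin d)}
    (hf : IntegrableOn f (Ioo a b)) {φ : ℝ → ℝ} (hc : Continuous φ) (hs : HasCompactSupport φ) :
    IntegrableOn (fun t => φ t • f t) (Ioo a b) := by
  obtain ⟨C, hC⟩ := hs.exists_bound_of_continuous hc
  exact hf.bdd_smul C hc.aestronglyMeasurable (Eventually.of_forall hC)

theorem IsWeakDeriv.add {a b : ℝ} {f f' g g' : ℝ → EuclideanSpace ℂ (Fin d)}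
    (h : IsWeakDeriv a b f g) (h' : IsWeakDeriv a b f' g')
    (hf : IntegrableOn f (Ioo a b)) (hf' : IntegrableOn f' (Ioo a b))
    (hg : IntegrableOn g (Ioo a b)) (hg' : IntegrableOn g' (Ioo a b)) :
    IsWeakDeriv a b (fun t => f t + f' t) (fun t => g t + g' t) := by
  intro φ h1 h2 h3
  have hd : Continuous (deriv φ) := h1.continuous_deriv (by simp)
  simp only [smul_add]
  rw [integral_add (integrableOn_test_smul hf hd h2.deriv)
      (integrableOn_test_smul hf' hd h2.deriv),
    integral_add (integrableOn_test_smul hg h1.continuous h2)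
      (integrableOn_test_smul hg' h1.continuous h2), h φ h1 h2 h3, h' φ h1 h2 h3, neg_add]

theorem IsWeakDeriv.smul {a b : ℝ} {f g : ℝ → EuclideanSpace ℂ (Fin d)}
    (h : IsWeakDeriv a b f g) (c : ℂ) :
    IsWeakDeriv a b (fun t => c • f t) (fun t => c • g t) := by
  intro φ h1 h2 h3
  simp only [smul_comm _ c]
  rw [integral_smul, integral_smul, h φ h1 h2 h3, smul_neg]

theorem isWeakDeriv_zero (a b : ℝ) :
    IsWeakDeriv a b (fun _ => (0 : EuclideanSpace ℂ (Fin d))) (fun _ => 0) := by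
  intro φ _ _ _
  simp

/-- The zero function has only zero as a weak derivative. -/
theorem IsWeakDeriv.ae_eq_zero {a b : ℝ} {g : ℝ → EuclideanSpace ℂ (Fin d)}
    (h : IsWeakDeriv a b (fun _ => 0) g) (hg : IntegrableOn g (Ioo a b)) :
    g =ᵐ[volume.restrict (Ioo a b)] fun _ => 0 := by
  have := isOpen_Ioo.ae_eq_zero_of_integral_contDiff_smul_eq_zero (μ := volume)
    (hg.locallyIntegrableOn) (fun φ h1 h2 h3 => by
      have h4 := h φ h1 h2 h3
      simp only [smul_zero, integral_zero] at h4
      have h5 : ∫ t in Ioo a b, φ t • g t = ∫ t, φ t • g t :=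
        setIntegral_eq_integral_of_forall_compl_eq_zero (fun t ht => by
          rw [image_eq_zero_of_notMem_tsupport (fun hh => ht (h3 hh)), zero_smul])
      rw [← h5]
      exact neg_eq_zero.1 h4.symm)
  exact (ae_restrict_iff' measurableSet_Ioo).2 this

theorem VanishesAtEnds.add {a b : ℝ} {f f' : ℝ → EuclideanSpace ℂ (Fin d)}
    (h : VanishesAtEnds a b f) (h' : VanishesAtEnds a b f') :
    VanishesAtEnds a b (fun t => f t + f' t) := by
  obtain ⟨u, hu, hfu, hua, hub⟩ := h
  obtain ⟨v, hv, hfv, hva, hvb⟩ := h'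
  refine ⟨fun t => u t + v t, hu.add hv, ?_, by simp [hua, hva], by simp [hub, hvb]⟩
  filter_upwards [hfu, hfv] with t h1 h2
  rw [h1, h2]

theorem VanishesAtEnds.smul {a b : ℝ} {f : ℝ → EuclideanSpace ℂ (Fin d)}
    (h : VanishesAtEnds a b f) (c : ℂ) : VanishesAtEnds a b (fun t => c • f t) := by
  obtain ⟨u, hu, hfu, hua, hub⟩ := h
  refine ⟨fun t => c • u t, hu.const_smul c, ?_, by simp [hua], by simp [hub]⟩
  filter_upwards [hfu] with t h1
  rw [h1]

theorem VanishesAtEnds.congr {a b : ℝ} {f f' : ℝ → EuclideanSpace ℂ (Fin d)}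
    (h : VanishesAtEnds a b f) (hf : f' =ᵐ[volume.restrict (Ioo a b)] f) :
    VanishesAtEnds a b f' := by
  obtain ⟨u, hu, hfu, hua, hub⟩ := h
  exact ⟨u, hu, hf.trans hfu, hua, hub⟩

/-- The graph of the minimal operator `x ↦ (P₁ (w e x e)')_e` on the network: `w e x e` lies in
`H¹(a e, b e)` and is zero at both ends of every edge, and the derivatives `(w e x e)'`, `e ∈ E`,
form an element `z` of the direct sum. The weights `w e` are positive. -/
def netGraph {E : Type*} (P₁ : Matrix (Fin d) (Fin d) ℂ) (a b : E → ℝ)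
    (w : E → {r : ℝ // 0 < r}) :
    Submodule ℂ (NetL2 d a b (fun e => (w e : ℝ)) × NetL2 d a b (fun e => (w e : ℝ))) where
  carrier := {p | ∃ z : NetL2 d a b (fun e => (w e : ℝ)), ∀ e,
    IsWeakDeriv (a e) (b e) (fun t => ((w e : ℝ) : ℂ) • p.1 e t) (z e) ∧
    VanishesAtEnds (a e) (b e) (fun t => ((w e : ℝ) : ℂ) • p.1 e t) ∧
    p.2 e =ᵐ[volume.restrict (Ioo (a e) (b e))] fun t => Matrix.toEuclideanLin P₁ (z e t)}
  add_mem' := by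
    rintro ⟨x, y⟩ ⟨x', y'⟩ ⟨z, hz⟩ ⟨z', hz'⟩
    refine ⟨z + z', fun e => ?_⟩
    obtain ⟨h1, h2, h3⟩ := hz e
    obtain ⟨h1', h2', h3'⟩ := hz' e
    have hx := ae_of_ae_edgeMeasure (w e).2 (Lp.coeFn_add (x e) (x' e))
    have hy := ae_of_ae_edgeMeasure (w e).2 (Lp.coeFn_add (y e) (y' e))
    have hzz := ae_of_ae_edgeMeasure (w e).2 (Lp.coeFn_add (z e) (z' e))
    have hfx : (fun t => ((w e : ℝ) : ℂ) • (x + x') e t) =ᵐ[volume.restrict (Ioo (a e) (b e))]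
        fun t => ((w e : ℝ) : ℂ) • x e t + ((w e : ℝ) : ℂ) • x' e t := by
      filter_upwards [hx] with t ht
      have : (x + x') e t = x e t + x' e t := ht
      rw [this, smul_add]
    refine ⟨?_, (h2.add h2').congr hfx, ?_⟩
    · refine (h1.add h1' ?_ ?_ (EdgeL2.integrableOn (w e).2 _)
        (EdgeL2.integrableOn (w e).2 _)).congr hfx hzz
      · exact Integrable.smul ((w e : ℝ) : ℂ) (EdgeL2.integrableOn (w e).2 (x e))
      · exact Integrable.smul ((w e : ℝ) : ℂ) (EdgeL2.integrableOn (w e).2 (x' e))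
    · filter_upwards [hy, hzz, h3, h3'] with t e1 e2 e3 e4
      have e1' : (y + y') e t = y e t + y' e t := e1
      have e2' : (z + z') e t = z e t + z' e t := e2
      change (y + y') e t = _
      rw [e1', e2', map_add]
      exact congrArg₂ (· + ·) e3 e4
  zero_mem' := by
    refine ⟨0, fun e => ?_⟩
    have h0 := ae_of_ae_edgeMeasure (w e).2
      (Lp.coeFn_zero (EuclideanSpace ℂ (Fin d)) 2 (edgeMeasure (a e) (b e) (w e)))
    have hf : (fun t => ((w e : ℝ) : ℂ) • (0 : NetL2 d a b (fun e => (w e : ℝ))) e t)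
        =ᵐ[volume.restrict (Ioo (a e) (b e))] fun _ => 0 := by
      filter_upwards [h0] with t ht
      have : (0 : NetL2 d a b (fun e => (w e : ℝ))) e t = 0 := ht
      rw [this, smul_zero]
    refine ⟨(isWeakDeriv_zero _ _).congr hf h0, ?_, ?_⟩
    · exact ⟨fun _ => 0, continuousOn_const, hf, rfl, rfl⟩
    · filter_upwards [h0] with t ht
      have : (0 : NetL2 d a b (fun e => (w e : ℝ))) e t = 0 := ht
      change (0 : NetL2 d a b (fun e => (w e : ℝ))) e t = _
      rw [this, map_zero]
  smul_mem' := by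
    rintro c ⟨x, y⟩ ⟨z, hz⟩
    refine ⟨c • z, fun e => ?_⟩
    obtain ⟨h1, h2, h3⟩ := hz e
    have hx := ae_of_ae_edgeMeasure (w e).2 (Lp.coeFn_smul c (x e))
    have hy := ae_of_ae_edgeMeasure (w e).2 (Lp.coeFn_smul c (y e))
    have hzz := ae_of_ae_edgeMeasure (w e).2 (Lp.coeFn_smul c (z e))
    have hfx : (fun t => ((w e : ℝ) : ℂ) • (c • x) e t) =ᵐ[volume.restrict (Ioo (a e) (b e))]
        fun t => c • ((w e : ℝ) : ℂ) • x e t := by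
      filter_upwards [hx] with t ht
      have : (c • x) e t = c • x e t := ht
      rw [this, smul_comm]
    refine ⟨(h1.smul c).congr hfx hzz, (h2.smul c).congr hfx, ?_⟩
    filter_upwards [hy, hzz, h3] with t e1 e2 e3
    have e1' : (c • y) e t = c • y e t := e1
    have e2' : (c • z) e t = c • z e t := e2
    change (c • y) e t = _
    rw [e1', e2', map_smul]
    exact congrArg (c • ·) e3

/-- `netGraph` is the graph of an operator, since weak derivatives are unique. -/
theorem netGraph_snd_eq_zero {E : Type*} (P₁ : Matrix (Fin d) (Fin d) ℂ) (a b : E → ℝ)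
    (w : E → {r : ℝ // 0 < r}) :
    ∀ p ∈ netGraph P₁ a b w, p.1 = 0 → p.2 = 0 := by
  rintro ⟨x, y⟩ ⟨z, hz⟩ (rfl : x = 0)
  ext1
  funext e
  obtain ⟨h1, -, h3⟩ := hz e
  have h0 := ae_of_ae_edgeMeasure (w e).2
    (Lp.coeFn_zero (EuclideanSpace ℂ (Fin d)) 2 (edgeMeasure (a e) (b e) (w e)))
  have hf : (fun _ => 0) =ᵐ[volume.restrict (Ioo (a e) (b e))]
      (fun t => ((w e : ℝ) : ℂ) • (0 : NetL2 d a b (fun e => (w e : ℝ))) e t) := by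
    filter_upwards [h0] with t ht
    have : (0 : NetL2 d a b (fun e => (w e : ℝ))) e t = 0 := ht
    rw [this, smul_zero]
  have hz0 := (h1.congr hf (EventuallyEq.refl _ _)).ae_eq_zero
    (EdgeL2.integrableOn (w e).2 (z e))
  refine Lp.ext (ae_edgeMeasure ?_)
  filter_upwards [hz0, h3, h0] with t e1 e2 e3
  have e2' : y e t = Matrix.toEuclideanLin P₁ (z e t) := e2
  change y e t = (0 : EdgeL2 d (a e) (b e) (w e)) t
  rw [e2', e1, map_zero]
  exact e3.symm

/-- The operator `x ↦ (P₁ (w e x e)')_e` on the direct sum of the spaces `L²_{w e}(a e, b e)`, with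
zero boundary values at both ends of every edge. -/
noncomputable def netOp {E : Type*} (P₁ : Matrix (Fin d) (Fin d) ℂ) (a b : E → ℝ)
    (w : E → {r : ℝ // 0 < r}) :
    NetL2 d a b (fun e => (w e : ℝ)) →ₗ.[ℂ] NetL2 d a b (fun e => (w e : ℝ)) :=
  (netGraph P₁ a b w).toLinearPMap

theorem netOp_graph {E : Type*} (P₁ : Matrix (Fin d) (Fin d) ℂ) (a b : E → ℝ)
    (w : E → {r : ℝ // 0 < r}) : (netOp P₁ a b w).graph = netGraph P₁ a b w :=
  Submodule.toLinearPMap_graph_eq _ fun _ _ => netGraph_snd_eq_zero P₁ a b w _ ‹_›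

/-- The weight `1` on every edge. -/
def unitWeight (E : Type*) : E → {r : ℝ // 0 < r} := fun _ => ⟨1, one_pos⟩

/-- The weight `1 / α_e` on the edge `e`, where `α_e = b e - a e`. -/
noncomputable def invLength {E : Type*} (a b : E → ℝ) (hab : ∀ e, a e < b e) :
    E → {r : ℝ // 0 < r} :=
  fun e => ⟨1 / (b e - a e), one_div_pos.2 (sub_pos.2 (hab e))⟩

/-- The operator `A : (φ_e) ↦ ((P₁ φ_e)')` on `⨁ L²(a e, b e)` with domain `⨁ H¹₀(a e, b e)`. -/
noncomputable abbrev arbOp {E : Type*} (P₁ : Matrix (Fin d) (Fin d) ℂ) (a b : E → ℝ) :=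
  netOp P₁ a b (unitWeight E)

/-- The operator `Ã`, that is, `A` for the case where all edges are `(0, 1)`. -/
noncomputable abbrev unitOp (E : Type*) (P₁ : Matrix (Fin d) (Fin d) ℂ) :=
  netOp P₁ (fun _ : E => 0) (fun _ => 1) (unitWeight E)

/-- The operator `(x_e) ↦ ((P₁ x_e / α_e)')` on `⨁ L²_{1/α_e}(0, 1)` with zero boundary values. -/
noncomputable abbrev scaledOp {E : Type*} (P₁ : Matrix (Fin d) (Fin d) ℂ) (a b : E → ℝ)
    (hab : ∀ e, a e < b e) :=
  netOp P₁ (fun _ : E => 0) (fun _ => 1) (invLength a b hab)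

/-- `f ∈ ker (1 + σ [∂ (w P₁)])`, where `[∂ (w P₁)] f = (w P₁ f)'` is the operator in `L²_w(0, 1)` with
domain `H¹(0, 1)` (no boundary conditions). -/
def MemEdgeKer (σ : ℝ) (P₁ : Matrix (Fin d) (Fin d) ℂ) (w : ℝ) (f : EdgeL2 d 0 1 w) : Prop :=
  ∃ z : EdgeL2 d 0 1 w, IsWeakDeriv 0 1 (fun t => (w : ℂ) • f t) z ∧
    ∀ᵐ t ∂volume.restrict (Ioo (0 : ℝ) 1), f t + (σ : ℂ) • Matrix.toEuclideanLin P₁ (z t) = 0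

/-- `c^σ_m = (-σ (m / 2) (e^{-2σ/m} - 1))^{1/2}`, the norm of `t ↦ e^{-σ t/m}` in `L²(0, 1)`, for
`σ = ±1` and `m ≠ 0`. -/
noncomputable def expNorm (σ m : ℝ) : ℝ :=
  √(-σ * (m / 2) * (Real.exp (-(2 * σ) / m) - 1))

/-- `ψ = S⋆ diag(S_{σ, m₁/α}, …, S_{σ, m_d/α}) S φ`, where, for a real `m ≠ 0`, `S_{σ, m/α}` takes a scalar
function `f` with `f + σ (m/α) f' = 0` to `c^σ_{m/α} / (α^{1/2} c^σ_m) f(· / α)`. Since `t / α` may leave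
`(0, 1)`, `φ` is replaced by the solution `u` on all of `ℝ` of `u + σ α⁻¹ P₁ u' = 0` extending it. -/
def IsEdgeRescaling (σ α : ℝ) (P₁ S : Matrix (Fin d) (Fin d) ℂ) (m : Fin d → ℝ)
    (φ ψ : ℝ → EuclideanSpace ℂ (Fin d)) : Prop :=
  ∃ u : ℝ → EuclideanSpace ℂ (Fin d), Differentiable ℝ u ∧
    (∀ t, u t + ((σ / α : ℝ) : ℂ) • Matrix.toEuclideanLin P₁ (deriv u t) = 0) ∧
    φ =ᵐ[volume.restrict (Ioo 0 1)] u ∧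
    ψ =ᵐ[volume.restrict (Ioo 0 1)] fun t => Matrix.toEuclideanLin
      (Sᴴ * Matrix.diagonal
        (fun k => ((expNorm σ (m k / α) / (√α * expNorm σ (m k)) : ℝ) : ℂ)) * S) (u (t / α))

end Network

end PHNetwork

namespace PHNetwork

/-! ### Dissipative operators and contractions between boundary spaces -/

section Dissipative

variable {X : Type*} [NormedAddCommGroup X] [InnerProductSpace ℂ X]

/-! Since `P₁` is Hermitian, integration by parts makes the minimal operator A skew-symmetric, and
A⋆ is minus the same differential expression without boundary conditions
(`mem_adjoint_netOp_graph_iff`). One operator `netOp` with edge weights covers all three operators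
of the theorem.

For a closed densely defined skew-symmetric A, ‖x - Ax‖² = ‖x‖² + ‖Ax‖², so 1 - A has closed range,
with orthogonal complement ker(1 - A⋆). Splitting y + A⋆y along this range gives D(A⋆) = D(A) ∔
ker(1 - A⋆) ∔ ker(1 + A⋆). The boundary form sees only the two kernel components, with opposite
signs (`boundaryForm_eq`), so √2 times the projections form a boundary system.

Along such a system, 2 Re⟨-A⋆x, x⟩ = ‖F₂x‖² - ‖F₁x‖². A restriction of -A⋆ is therefore dissipative
exactly when F₁x ↦ F₂x is a contractive relation. Such a relation always extends to a contraction on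
the whole space, so the maximal restrictions are those cut out by contractions. Nothing is lost by
staying below -A⋆: a dissipative extension of A cannot leave it (`IsDissipative.inner_eq_neg`). For
-H the two boundary maps exchange roles.

It remains to move everything to the model edges. An affine substitution on each edge, with factor
1/α, is unitary and intertwines the operator on the edges (a(e), b(e)) with the weighted one on (0,
1). Diagonalizing `P₁` turns the kernel equations into scalar ones solved by exponentials.
Normalized exponentials identify every deficiency space with ℓ²(E; ℂᵈ), whatever the weights
(`mem_range_edgeKerIsometry`), and S₊ and S₋ just match coordinates. -/

theorem eq_zero_of_forall_mul_le {c r : ℝ} (h : ∀ s : ℝ, s * c ≤ r) : c = 0 := by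
  by_contra hc
  have := h ((r + 1) / c)
  rw [div_mul_cancel₀ _ hc] at this
  linarith

/-- Dissipativity is tested on y + s c̄ x, where c is the defect of the claimed identity. By `hx`
the term quadratic in s has real part zero, so Re⟨Ky, y⟩ + s‖c‖² ≤ 0 for every real s, which forces
c = 0. -/
theorem IsDissipative.inner_eq_neg {K : X →ₗ.[ℂ] X} (hK : IsDissipative K) (x y : K.domain)
    (hx : (inner ℂ (K x) (x : X)).re = 0) :
    inner ℂ (K y) (x : X) = - inner ℂ (y : X) (K x) := by
  set c : ℂ := inner ℂ (K y) (x : X) + inner ℂ (y : X) (K x) with hc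
  suffices hc0 : ‖c‖ ^ 2 = 0 by
    have : c = 0 := by simpa using hc0
    exact eq_neg_of_add_eq_zero_left this
  refine eq_zero_of_forall_mul_le (r := -(inner ℂ (K y) (y : X)).re) fun s => ?_
  have h := hK (y + ((s : ℂ) * starRingEnd ℂ c) • x)
  have h2 : (inner ℂ (K x) (y : X)) = starRingEnd ℂ (inner ℂ (y : X) (K x)) :=
    (inner_conj_symm _ _).symm
  rw [LinearPMap.map_add, LinearPMap.map_smul] at h
  simp only [Submodule.coe_add, Submodule.coe_smul, inner_add_left, inner_add_right,
    inner_smul_left, inner_smul_right, map_mul, Complex.conj_conj, Complex.conj_ofReal] at h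
  have e : s * ‖c‖ ^ 2 = ((s : ℂ) * starRingEnd ℂ c * c).re := by
    rw [mul_assoc, Complex.conj_mul', ← Complex.ofReal_pow, ← Complex.ofReal_mul,
      Complex.ofReal_re]
  have e2 : ((s : ℂ) * c * inner ℂ (K x) (y : X)).re
      = ((s : ℂ) * starRingEnd ℂ c * inner ℂ (y : X) (K x)).re := by
    rw [h2, ← Complex.conj_re]
    simp
  have e3 : ((s : ℂ) * c * ((s : ℂ) * starRingEnd ℂ c * inner ℂ (K x) (x : X))).re = 0 := by
    have : (s : ℂ) * c * ((s : ℂ) * starRingEnd ℂ c * inner ℂ (K x) (x : X))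
        = ((s ^ 2 * ‖c‖ ^ 2 : ℝ) : ℂ) * inner ℂ (K x) (x : X) := by
      push_cast
      rw [← Complex.mul_conj']
      ring
    rw [this, Complex.re_ofReal_mul, hx, mul_zero]
  have e4 : (s : ℂ) * starRingEnd ℂ c * c
      = (s : ℂ) * starRingEnd ℂ c * inner ℂ (K y) (x : X)
        + (s : ℂ) * starRingEnd ℂ c * inner ℂ (y : X) (K x) := by
    rw [hc]; ring
  rw [e, e4, Complex.add_re]
  simp only [mul_add, Complex.add_re] at h
  have e5 : (s : ℂ) * starRingEnd ℂ c * ((s : ℂ) * c * inner ℂ (K x) (x : X))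
      = (s : ℂ) * c * ((s : ℂ) * starRingEnd ℂ c * inner ℂ (K x) (x : X)) := by ring
  rw [e5] at h
  linarith

variable {G₁ G₂ : Type*} [NormedAddCommGroup G₁] [InnerProductSpace ℂ G₁]
  [NormedAddCommGroup G₂] [InnerProductSpace ℂ G₂]

/-- A linear relation `{(p x, q x)}` with `‖q x‖ ≤ ‖p x‖` extends to a contraction. -/
theorem exists_contraction_of_norm_le [CompleteSpace G₁] [CompleteSpace G₂]
    {V : Type*} [AddCommGroup V] [Module ℂ V] (p : V →ₗ[ℂ] G₁) (q : V →ₗ[ℂ] G₂)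
    (h : ∀ x, ‖q x‖ ≤ ‖p x‖) :
    ∃ T : G₁ →L[ℂ] G₂, ‖T‖ ≤ 1 ∧ ∀ x, T (p x) = q x := by
  -- The relation is a bounded map on the range of `p`. It extends by continuity to the closure and
  -- by zero to the orthogonal complement, neither of which raises the norm above 1.
  let R := (LinearMap.range p).topologicalClosure
  have hmem : ∀ x, p x ∈ R := fun x =>
    Submodule.le_topologicalClosure _ (LinearMap.mem_range_self p x)
  let e : V →ₗ[ℂ] R := p.codRestrict R hmem
  have : CompleteSpace R := (Submodule.isClosed_topologicalClosure _).completeSpace_coe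
  have hd : DenseRange e := by
    intro y
    have hy : (y : G₁) ∈ closure (LinearMap.range p : Set G₁) := y.2
    rw [closure_subtype]
    convert hy using 2
    ext z
    constructor
    · rintro ⟨_, ⟨x, rfl⟩, rfl⟩
      exact ⟨x, rfl⟩
    · rintro ⟨x, rfl⟩
      exact ⟨e x, ⟨x, rfl⟩, rfl⟩
  have hb : ∀ x, ‖q x‖ ≤ 1 * ‖e x‖ := fun x => by rw [one_mul]; exact h x
  refine ⟨(q.extendOfNorm e).comp R.orthogonalProjectionOnto, ?_, fun x => ?_⟩
  · refine (ContinuousLinearMap.opNorm_comp_le _ _).trans ?_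
    exact mul_le_one₀ (LinearMap.opNorm_extendOfNorm_le hd zero_le_one hb) (norm_nonneg _)
      (Submodule.orthogonalProjectionOnto_norm_le _)
  · have : R.orthogonalProjectionOnto (p x) = e x :=
      Submodule.orthogonalProjectionOnto_mem_subspace_eq_self (e x)
    rw [ContinuousLinearMap.comp_apply, this, LinearMap.extendOfNorm_eq hd ⟨1, hb⟩]

/-- Maximal dissipative restrictions of `M` correspond to contractions between boundary spaces. -/
theorem isMaximalDissipative_iff_exists_contraction [CompleteSpace G₁] [CompleteSpace G₂]
    (M H : X →ₗ.[ℂ] X) (F₁ : M.domain →ₗ[ℂ] G₁) (F₂ : M.domain →ₗ[ℂ] G₂)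
    (hsurj : ∀ g₁ g₂, ∃ x, F₁ x = g₁ ∧ F₂ x = g₂)
    (hform : ∀ x : M.domain, 2 * (inner ℂ (M x) (x : X)).re = ‖F₂ x‖ ^ 2 - ‖F₁ x‖ ^ 2)
    (hHM : H ≤ M) (hext : ∀ K : X →ₗ.[ℂ] X, IsDissipative K → H ≤ K → K ≤ M) :
    IsMaximalDissipative H ↔ ∃ T : G₁ →L[ℂ] G₂, ‖T‖ ≤ 1 ∧
      ∀ x, x ∈ H.domain ↔ ∃ hx : x ∈ M.domain, T (F₁ ⟨x, hx⟩) = F₂ ⟨x, hx⟩ := by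
  -- By `hform`, dissipativity below `M` is a comparison of boundary norms.
  have key : ∀ K : X →ₗ.[ℂ] X, ∀ hKM : K ≤ M, IsDissipative K ↔
      ∀ x (hx : x ∈ K.domain), ‖F₂ ⟨x, hKM.1 hx⟩‖ ≤ ‖F₁ ⟨x, hKM.1 hx⟩‖ := by
    intro K hKM
    have h1 : ∀ x (hx : x ∈ K.domain), 2 * (inner ℂ (K ⟨x, hx⟩) x).re
        = ‖F₂ ⟨x, hKM.1 hx⟩‖ ^ 2 - ‖F₁ ⟨x, hKM.1 hx⟩‖ ^ 2 := fun x hx => by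
      rw [hKM.2 (x := ⟨x, hx⟩) (y := ⟨x, hKM.1 hx⟩) rfl, hform]
    constructor
    · intro h x hx
      have := h1 x hx
      have h2 := h ⟨x, hx⟩
      refine le_of_sq_le_sq ?_ (norm_nonneg _)
      simp only at h2
      linarith
    · rintro h ⟨x, hx⟩
      have := h1 x hx
      have h2 := pow_le_pow_left₀ (norm_nonneg _) (h x hx) 2
      simp only
      linarith
  have hdiss : ∀ K : X →ₗ.[ℂ] X, K ≤ M → ∀ T : G₁ →L[ℂ] G₂, ‖T‖ ≤ 1 →
      (∀ x, x ∈ K.domain → ∃ hx : x ∈ M.domain, T (F₁ ⟨x, hx⟩) = F₂ ⟨x, hx⟩) →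
      IsDissipative K := by
    intro K hKM T hT h
    rw [key K hKM]
    intro x hx
    obtain ⟨hx', e⟩ := h x hx
    rw [← e]
    exact (T.le_of_opNorm_le hT _).trans_eq (one_mul _)
  constructor
  · rintro ⟨hd, hmax⟩
    obtain ⟨T, hT, hTe⟩ := exists_contraction_of_norm_le
      (F₁.comp (Submodule.inclusion hHM.1)) (F₂.comp (Submodule.inclusion hHM.1))
      (fun x => (key H hHM).1 hd x x.2)
    refine ⟨T, hT, ?_⟩
    -- The restriction of `M` to the vectors whose boundary values lie on the graph of `T` is
    -- dissipative and extends `H`, so maximality identifies the two.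
    let K : X →ₗ.[ℂ] X := M.domRestrict
      ((LinearMap.ker ((T : G₁ →ₗ[ℂ] G₂).comp F₁ - F₂)).map M.domain.subtype)
    have hKM : K ≤ M := LinearPMap.domRestrict_le
    have hK : ∀ x, x ∈ K.domain ↔ ∃ hx : x ∈ M.domain, T (F₁ ⟨x, hx⟩) = F₂ ⟨x, hx⟩ := by
      intro x
      constructor
      · rintro ⟨⟨y, hy, rfl⟩, -⟩
        exact ⟨y.2, sub_eq_zero.1 hy⟩
      · rintro ⟨hx, e⟩
        exact ⟨⟨⟨x, hx⟩, sub_eq_zero.2 e, rfl⟩, hx⟩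
    have hHK : H ≤ K := by
      refine ⟨fun x hx => (hK x).2 ⟨hHM.1 hx, hTe ⟨x, hx⟩⟩, fun x y hxy => ?_⟩
      rw [hHM.2 (x := x) (y := ⟨y, hKM.1 y.2⟩) hxy, hKM.2 (x := y) (y := ⟨y, hKM.1 y.2⟩) rfl]
    have hKH := hmax K (hdiss K hKM T hT fun x hx => (hK x).1 hx) hHK
    intro x
    rw [← hK, hKH]
  · rintro ⟨T, hT, hTe⟩
    refine ⟨hdiss H hHM T hT fun x hx => (hTe x).1 hx, fun K hKd hHK => ?_⟩
    have hKM := hext K hKd hHK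
    refine (LinearPMap.eq_of_le_of_domain_eq hHK (le_antisymm hHK.1 fun y hy => ?_)).symm
    -- Surjectivity yields x with the same first boundary value as y and with boundary values on the
    -- graph of `T`, hence x ∈ D(H). As F₁(y - x) = 0, dissipativity of K gives F₂(y - x) = 0, so y
    -- satisfies the boundary condition too.
    obtain ⟨x, hx1, hx2⟩ := hsurj (F₁ ⟨y, hKM.1 hy⟩) (T (F₁ ⟨y, hKM.1 hy⟩))
    have hxH : (x : X) ∈ H.domain := (hTe x).2 ⟨x.2, by rw [hx1, hx2]⟩
    have hd := (key K hKM).1 hKd (y - x) (sub_mem hy (hHK.1 hxH))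
    have e : (⟨y - x, hKM.1 (sub_mem hy (hHK.1 hxH))⟩ : M.domain) = ⟨y, hKM.1 hy⟩ - x := rfl
    rw [e, map_sub, map_sub, hx1, sub_self, norm_zero, norm_le_zero_iff, sub_eq_zero, hx2] at hd
    exact (hTe y).2 ⟨hKM.1 hy, hd.symm⟩

end Dissipative

/-! ### Closed skew-symmetric operators: von Neumann decomposition and boundary system -/

section Adjoint

variable {X : Type*} [NormedAddCommGroup X] [InnerProductSpace ℂ X]

/-- `A` is skew-symmetric: `⟨A x, y⟩ = -⟨x, A y⟩` on its domain. -/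
def IsSkewSymmetric (A : X →ₗ.[ℂ] X) : Prop :=
  ∀ p ∈ A.graph, ∀ q ∈ A.graph, inner ℂ p.2 q.1 = - inner ℂ p.1 q.2

theorem IsSkewSymmetric.re_inner_eq_zero {A : X →ₗ.[ℂ] X} (hs : IsSkewSymmetric A) (x : A.domain) :
    (inner ℂ (A x) (x : X)).re = 0 := by
  have h := congrArg Complex.re (hs _ (A.mem_graph x) _ (A.mem_graph x))
  have h2 := inner_re_symm (𝕜 := ℂ) (x : X) (A x)
  simp only [RCLike.re_to_complex] at h2
  simp only [Complex.neg_re] at h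
  linarith

/-- Skew-symmetry makes the cross term purely imaginary. The identity bounds 1 - A below in the
graph norm. -/
theorem IsSkewSymmetric.norm_sub_sq {A : X →ₗ.[ℂ] X} (hs : IsSkewSymmetric A) {p : X × X} (hp : p ∈ A.graph) :
    ‖p.1 - p.2‖ ^ 2 = ‖p.1‖ ^ 2 + ‖p.2‖ ^ 2 := by
  have h := congrArg Complex.re (hs _ hp _ hp)
  have h2 := inner_re_symm (𝕜 := ℂ) p.1 p.2
  rw [_root_.norm_sub_sq (𝕜 := ℂ)]
  simp only [RCLike.re_to_complex] at h2 ⊢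
  simp only [Complex.neg_re] at h
  linarith

variable [CompleteSpace X]

theorem mem_adjoint_graph_iff {A : X →ₗ.[ℂ] X} (hA : Dense (A.domain : Set X)) {y v : X} :
    (y, v) ∈ A.adjoint.graph ↔ ∀ p ∈ A.graph, inner ℂ p.1 v = inner ℂ p.2 y := by
  rw [LinearPMap.adjoint_graph_eq_graph_adjoint hA, Submodule.mem_adjoint_iff]
  constructor
  · intro h p hp
    exact (sub_eq_zero.1 (h p.1 p.2 hp)).symm
  · intro h a b hab
    exact sub_eq_zero.2 (h (a, b) hab).symm

theorem mem_kerOneSubAdjoint {A : X →ₗ.[ℂ] X} {x : X} :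
    x ∈ kerOneSubAdjoint A ↔ (x, x) ∈ A.adjoint.graph := Iff.rfl

theorem mem_kerOneAddAdjoint {A : X →ₗ.[ℂ] X} {x : X} :
    x ∈ kerOneAddAdjoint A ↔ (x, -x) ∈ A.adjoint.graph := Iff.rfl

theorem isClosed_kerOneSubAdjoint {A : X →ₗ.[ℂ] X} (hA : Dense (A.domain : Set X)) :
    IsClosed (kerOneSubAdjoint A : Set X) :=
  (LinearPMap.adjoint_isClosed hA).preimage (by fun_prop : Continuous fun x : X => (x, x))

theorem isClosed_kerOneAddAdjoint {A : X →ₗ.[ℂ] X} (hA : Dense (A.domain : Set X)) :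
    IsClosed (kerOneAddAdjoint A : Set X) :=
  (LinearPMap.adjoint_isClosed hA).preimage (by fun_prop : Continuous fun x : X => (x, -x))

variable {A : X →ₗ.[ℂ] X}

theorem isSkewSymmetric_of_le_neg_adjoint (hA : Dense (A.domain : Set X))
    (h : A ≤ -A.adjoint) : IsSkewSymmetric A := by
  rintro ⟨x, x'⟩ hx ⟨y, y'⟩ hy
  have h1 := LinearPMap.le_graph_of_le h hy
  have h2 : (y, -y') ∈ A.adjoint.graph := by
    rw [LinearPMap.neg_graph] at h1
    obtain ⟨⟨u, v⟩, huv, e⟩ := h1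
    simp only [LinearMap.prodMap_apply, LinearMap.id_apply, LinearMap.neg_apply,
      Prod.mk.injEq] at e
    obtain ⟨rfl, rfl⟩ := e
    simpa using huv
  have := (mem_adjoint_graph_iff hA).1 h2 _ hx
  simp only [inner_neg_right] at this
  exact this.symm

theorem IsSkewSymmetric.mem_adjoint_graph (hs : IsSkewSymmetric A)
    (hA : Dense (A.domain : Set X)) {p : X × X} (hp : p ∈ A.graph) :
    (p.1, -p.2) ∈ A.adjoint.graph := by
  rw [mem_adjoint_graph_iff hA]
  intro q hq
  rw [inner_neg_right, hs q hq p hp]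

theorem IsSkewSymmetric.domain_le (hs : IsSkewSymmetric A) (hA : Dense (A.domain : Set X)) :
    A.domain ≤ A.adjoint.domain := fun x hx =>
  LinearPMap.mem_domain_of_mem_graph (hs.mem_adjoint_graph hA (A.mem_graph ⟨x, hx⟩))

/-- By `IsSkewSymmetric.norm_sub_sq` the map (x, Ax) ↦ x - Ax is antilipschitz on the graph, which
is complete because A is closed. -/
theorem IsSkewSymmetric.isClosed_range (hs : IsSkewSymmetric A) (hc : A.IsClosed) :
    IsClosed (A.graph.map (LinearMap.fst ℂ X X - LinearMap.snd ℂ X X) : Set X) := by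
  have : CompleteSpace A.graph := IsClosed.completeSpace_coe (hs := hc)
  let f : A.graph →L[ℂ] X :=
    (ContinuousLinearMap.fst ℂ X X - ContinuousLinearMap.snd ℂ X X).comp A.graph.subtypeL
  have hf : AntilipschitzWith 1 f := by
    refine AddMonoidHomClass.antilipschitz_of_bound f fun p => ?_
    have h := hs.norm_sub_sq p.2
    rw [NNReal.coe_one, one_mul]
    change ‖(p : X × X)‖ ≤ ‖(p : X × X).1 - (p : X × X).2‖
    rw [Prod.norm_def, max_le_iff]
    constructor <;> refine le_of_sq_le_sq ?_ (norm_nonneg _) <;> rw [h] <;> simp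
  convert hf.isClosed_range f.uniformContinuous
  ext x
  constructor
  · rintro ⟨p, hp, rfl⟩
    exact ⟨⟨p, hp⟩, rfl⟩
  · rintro ⟨p, rfl⟩
    exact ⟨p, p.2, rfl⟩

/-- The existence part of `D(A⋆) = D(A) ∔ ker (1 - A⋆) ∔ ker (1 + A⋆)`. -/
theorem IsSkewSymmetric.exists_decomposition (hs : IsSkewSymmetric A)
    (hA : Dense (A.domain : Set X)) (hc : A.IsClosed) {y : X} (hy : y ∈ A.adjoint.domain) :
    ∃ x ∈ A.domain, ∃ g₁ ∈ kerOneSubAdjoint A, ∃ g₂ ∈ kerOneAddAdjoint A, y = x + g₁ + g₂ := by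
  obtain ⟨v, hv⟩ := LinearPMap.mem_domain_iff.1 hy
  set R := A.graph.map (LinearMap.fst ℂ X X - LinearMap.snd ℂ X X)
  have : CompleteSpace R := IsClosed.completeSpace_coe (hs := hs.isClosed_range hc)
  -- This writes y + A⋆y = (x - Ax) + g with g orthogonal to the range of 1 - A, that is, g ∈ ker(1
  -- - A⋆).
  obtain ⟨r, ⟨⟨x, x'⟩, hx, hr⟩, g, hg, hyv⟩ := R.exists_add_mem_mem_orthogonal (y + v)
  have hr' : r = x - x' := hr.symm
  have hgk : g ∈ kerOneSubAdjoint A := by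
    rw [mem_kerOneSubAdjoint, mem_adjoint_graph_iff hA]
    rintro ⟨z, z'⟩ hz
    have := (Submodule.mem_orthogonal _ _).1 hg (z - z') ⟨_, hz, rfl⟩
    rw [inner_sub_left, sub_eq_zero] at this
    exact this
  have hgk2 : (2⁻¹ : ℂ) • g ∈ kerOneSubAdjoint A := Submodule.smul_mem _ _ hgk
  -- With g/2 as first kernel component, z = y - x - g/2 satisfies A⋆z = v + Ax - g/2 = -(y - x -
  -- g/2), because v = x - Ax + g - y.
  refine ⟨x, LinearPMap.mem_domain_of_mem_graph hx, _, hgk2, y - x - (2⁻¹ : ℂ) • g, ?_, by abel⟩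
  rw [mem_kerOneAddAdjoint]
  have h := sub_mem (sub_mem hv (hs.mem_adjoint_graph hA hx)) (mem_kerOneSubAdjoint.1 hgk2)
  convert h using 1
  simp only [Prod.mk_sub_mk, Prod.mk.injEq, true_and]
  have hv' : v = x - x' + g - y := by rw [← hr', ← hyv]; abel
  have hg2 : g = (2⁻¹ : ℂ) • g + (2⁻¹ : ℂ) • g := by rw [← add_smul]; norm_num
  rw [hv']
  nth_rw 2 [hg2]
  abel

/-- The boundary form `⟨x, A⋆ y⟩ + ⟨A⋆ x, y⟩`. -/
theorem boundaryForm_eq (hs : IsSkewSymmetric A) (hA : Dense (A.domain : Set X))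
    {x x' y y' a b g₁ g₂ h₁ h₂ : X} (hx : (x, x') ∈ A.adjoint.graph)
    (hy : (y, y') ∈ A.adjoint.graph) (ha : a ∈ A.domain) (hb : b ∈ A.domain)
    (hg₁ : g₁ ∈ kerOneSubAdjoint A) (hg₂ : g₂ ∈ kerOneAddAdjoint A)
    (hh₁ : h₁ ∈ kerOneSubAdjoint A) (hh₂ : h₂ ∈ kerOneAddAdjoint A)
    (ex : x = a + g₁ + g₂) (ey : y = b + h₁ + h₂) :
    inner ℂ x y' + inner ℂ x' y = 2 * inner ℂ g₁ h₁ - 2 * inner ℂ g₂ h₂ := by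
  obtain ⟨a', ha'⟩ := LinearPMap.mem_domain_iff.1 ha
  obtain ⟨b', hb'⟩ := LinearPMap.mem_domain_iff.1 hb
  have ex' : x' = -a' + g₁ + -g₂ := LinearPMap.mem_graph_snd_inj _ hx
    (add_mem (add_mem (hs.mem_adjoint_graph hA ha') hg₁) hg₂) ex
  have ey' : y' = -b' + h₁ + -h₂ := LinearPMap.mem_graph_snd_inj _ hy
    (add_mem (add_mem (hs.mem_adjoint_graph hA hb') hh₁) hh₂) ey
  have key : ∀ {u u' p p' : X}, (u, u') ∈ A.adjoint.graph → (p, p') ∈ A.graph →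
      inner ℂ p u' = inner ℂ p' u := fun hu hp => (mem_adjoint_graph_iff hA).1 hu _ hp
  have key' : ∀ {u u' p p' : X}, (u, u') ∈ A.adjoint.graph → (p, p') ∈ A.graph →
      inner ℂ u' p = inner ℂ u p' := fun hu hp => by
    rw [← inner_conj_symm, key hu hp, inner_conj_symm]
  -- All pairings with a or b cancel, by skew-symmetry or by the adjoint relation. The mixed terms
  -- between the two kernels cancel because A⋆ acts on them with opposite signs.
  have k1 : inner ℂ a' b = -inner ℂ a b' := hs _ ha' _ hb'
  have k2 := key (mem_kerOneSubAdjoint.1 hh₁) ha'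
  have k3 := key (mem_kerOneAddAdjoint.1 hh₂) ha'
  have k4 := key' (mem_kerOneSubAdjoint.1 hg₁) hb'
  have k5 := key' (mem_kerOneAddAdjoint.1 hg₂) hb'
  simp only [inner_neg_right, inner_neg_left] at k3 k5
  rw [ex', ey', ex, ey]
  simp only [inner_add_left, inner_add_right, inner_neg_left, inner_neg_right]
  rw [← k2, k1, ← k4, ← k3, ← k5]
  ring

/-- The boundary form of 0 = x + g₁ + g₂ against g₁ and against g₂ gives 0 = 2‖g₁‖² and 0 = -2‖g₂‖².
-/
theorem IsSkewSymmetric.decomposition_unique (hs : IsSkewSymmetric A)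
    (hA : Dense (A.domain : Set X)) {x g₁ g₂ : X} (hx : x ∈ A.domain)
    (hg₁ : g₁ ∈ kerOneSubAdjoint A) (hg₂ : g₂ ∈ kerOneAddAdjoint A) (h : x + g₁ + g₂ = 0) :
    g₁ = 0 ∧ g₂ = 0 := by
  have h0 : ((0 : X), (0 : X)) ∈ A.adjoint.graph := zero_mem _
  have h1 := boundaryForm_eq hs hA h0 hg₁ hx (zero_mem _) hg₁ hg₂ hg₁ (zero_mem _) h.symm
    (show g₁ = 0 + g₁ + 0 by simp)
  have h2 := boundaryForm_eq hs hA h0 hg₂ hx (zero_mem _) hg₁ hg₂ (zero_mem _) hg₂ h.symm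
    (show g₂ = 0 + 0 + g₂ by simp)
  simp only [inner_zero_left, inner_zero_right] at h1 h2
  constructor
  · simpa using h1
  · simpa using h2

/-- The sum map from D(A) × ker(1 - A⋆) × ker(1 + A⋆) to D(A⋆) is bijective. `F` reads off the last
two components of its inverse, and the factor √2 absorbs the 2 in `boundaryForm_eq`. -/
theorem IsSkewSymmetric.exists_canonicalBoundaryMap (hs : IsSkewSymmetric A)
    (hA : Dense (A.domain : Set X)) (hc : A.IsClosed) :
    ∃ F : A.adjoint.domain →ₗ[ℂ] kerOneSubAdjoint A × kerOneAddAdjoint A,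
      IsCanonicalBoundaryMap A F ∧ IsBoundarySystem A F := by
  have hG₁ : ∀ g : kerOneSubAdjoint A, (g : X) ∈ A.adjoint.domain :=
    fun g => LinearPMap.mem_domain_of_mem_graph g.2
  have hG₂ : ∀ g : kerOneAddAdjoint A, (g : X) ∈ A.adjoint.domain :=
    fun g => LinearPMap.mem_domain_of_mem_graph g.2
  let Φ : A.domain × kerOneSubAdjoint A × kerOneAddAdjoint A →ₗ[ℂ] A.adjoint.domain :=
    (Submodule.inclusion (hs.domain_le hA)).coprod
      (((kerOneSubAdjoint A).subtype.codRestrict _ hG₁).coprod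
        ((kerOneAddAdjoint A).subtype.codRestrict _ hG₂))
  have hΦ : ∀ x g₁ g₂, ((Φ (x, g₁, g₂) : A.adjoint.domain) : X) = x + g₁ + g₂ :=
    fun x g₁ g₂ => (add_assoc _ _ _).symm
  have hbij : Function.Bijective Φ := by
    constructor
    · rw [← LinearMap.ker_eq_bot, LinearMap.ker_eq_bot']
      rintro ⟨x, g₁, g₂⟩ h
      have h' : (x : X) + g₁ + g₂ = 0 := by rw [← hΦ, h]; rfl
      obtain ⟨h1, h2⟩ := hs.decomposition_unique hA x.2 g₁.2 g₂.2 h'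
      rw [h1, h2, add_zero, add_zero] at h'
      ext <;> assumption
    · rintro ⟨y, hy⟩
      obtain ⟨x, hx, g₁, hg₁, g₂, hg₂, e⟩ := hs.exists_decomposition hA hc hy
      exact ⟨(⟨x, hx⟩, ⟨g₁, hg₁⟩, ⟨g₂, hg₂⟩), Subtype.ext ((hΦ _ _ _).trans e.symm)⟩
  let e := LinearEquiv.ofBijective Φ hbij
  let F : A.adjoint.domain →ₗ[ℂ] kerOneSubAdjoint A × kerOneAddAdjoint A :=
    ((√2 : ℝ) : ℂ) • (LinearMap.snd ℂ _ _).comp e.symm.toLinearMap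
  have hF : ∀ x g₁ g₂, F (Φ (x, g₁, g₂)) = (((√2 : ℝ) : ℂ) • g₁, ((√2 : ℝ) : ℂ) • g₂) := by
    intro x g₁ g₂
    change ((√2 : ℝ) : ℂ) • (e.symm (e (x, g₁, g₂))).2 = _
    rw [LinearEquiv.symm_apply_apply]
    rfl
  have hne : ((√2 : ℝ) : ℂ) ≠ 0 := by simp
  refine ⟨F, ?_, ?_, ?_⟩
  · intro y g₁ g₂
    obtain ⟨⟨x, h₁, h₂⟩, rfl⟩ := hbij.2 y
    rw [hF, hΦ, Prod.mk.injEq]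
    constructor
    · intro h
      have := hs.decomposition_unique hA (sub_mem x.2 h) (sub_mem h₁.2 g₁.2) (sub_mem h₂.2 g₂.2) ?_
      · rw [sub_eq_zero, sub_eq_zero] at this
        rw [Subtype.ext this.1, Subtype.ext this.2]
        exact ⟨rfl, rfl⟩
      · abel
    · rintro ⟨e1, e2⟩
      rw [← smul_right_injective _ hne e1, ← smul_right_injective _ hne e2]
      convert x.2 using 1
      abel
  · rintro ⟨g₁, g₂⟩
    refine ⟨Φ (0, ((√2 : ℝ) : ℂ)⁻¹ • g₁, ((√2 : ℝ) : ℂ)⁻¹ • g₂), ?_⟩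
    rw [hF, smul_inv_smul₀ hne, smul_inv_smul₀ hne]
  · intro x y
    obtain ⟨⟨a, g₁, g₂⟩, rfl⟩ := hbij.2 x
    obtain ⟨⟨b, h₁, h₂⟩, rfl⟩ := hbij.2 y
    rw [hF, hF, boundaryForm_eq hs hA (A.adjoint.mem_graph _) (A.adjoint.mem_graph _) a.2 b.2
      g₁.2 g₂.2 h₁.2 h₂.2 (hΦ _ _ _) (hΦ _ _ _)]
    have h2 : ((√2 : ℝ) : ℂ) * ((√2 : ℝ) : ℂ) = 2 := by
      rw [← Complex.ofReal_mul]; simp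
    simp only [inner_smul_left, inner_smul_right, Complex.conj_ofReal, ← mul_assoc, h2]
    rfl

end Adjoint

/-! ### Primitives, Fubini and the lemma of du Bois-Reymond -/

section Calculus

variable {E F G : Type*} [NormedAddCommGroup E] [NormedSpace ℝ E]
  [NormedAddCommGroup F] [NormedAddCommGroup G] [NormedSpace ℝ G] {a b : ℝ}

theorem integrableOn_Ioo_of_continuous {f : ℝ → F} (hf : Continuous f) :
    IntegrableOn f (Ioo a b) :=
  (hf.integrableOn_Icc).mono_set Ioo_subset_Icc_self

variable [NormedSpace ℝ F]

theorem integral_Ioo_deriv {φ : ℝ → ℝ} (hφ : ContDiff ℝ ∞ φ) {s t : ℝ} (h : s ≤ t) :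
    ∫ x in Ioo s t, deriv φ x = φ t - φ s := by
  rw [← integral_Ioc_eq_integral_Ioo, ← intervalIntegral.integral_of_le h]
  refine intervalIntegral.integral_deriv_eq_sub
    (fun x _ => (hφ.differentiable (by simp)).differentiableAt) ?_
  exact (hφ.continuous_deriv (by simp)).intervalIntegrable _ _

theorem integrableOn_Ioo_continuous_smul {f : ℝ → F} (hf : IntegrableOn f (Ioo a b)) {φ : ℝ → ℝ}
    (hφ : Continuous φ) : IntegrableOn (fun t => φ t • f t) (Ioo a b) := by
  obtain ⟨C, hC⟩ := isCompact_Icc.exists_bound_of_continuousOn (s := Icc a b) hφ.continuousOn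
  refine hf.bdd_smul C hφ.aestronglyMeasurable ?_
  filter_upwards [ae_restrict_mem measurableSet_Ioo] with t ht
  exact hC t (Ioo_subset_Icc_self ht)

theorem continuousOn_primitive_Ioo {z : ℝ → F} (hz : IntegrableOn z (Ioo a b)) :
    ContinuousOn (fun t => ∫ s in Ioo a t, z s) (Icc a b) := by
  simp only [← integral_Ioc_eq_integral_Ioo]
  exact intervalIntegral.continuousOn_primitive ((integrableOn_Icc_iff_integrableOn_Ioo).2 hz)

theorem setIntegral_testFunction_smul {φ : ℝ → ℝ} (hs : tsupport φ ⊆ Ioo a b) (f : ℝ → F) :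
    ∫ t in Ioo a b, φ t • f t = ∫ t, φ t • f t :=
  setIntegral_eq_integral_of_forall_compl_eq_zero fun t ht => by
    rw [image_eq_zero_of_notMem_tsupport (fun h => ht (hs h)), zero_smul]

/-- A smooth function with integral zero is the derivative of a test function. -/
theorem exists_testFunction_deriv_eq {h : ℝ → ℝ} (hh : ContDiff ℝ ∞ h) (hc : HasCompactSupport h)
    (hs : tsupport h ⊆ Ioo a b) (h0 : ∫ t, h t = 0) :
    ∃ φ : ℝ → ℝ, ContDiff ℝ ∞ φ ∧ HasCompactSupport φ ∧ tsupport φ ⊆ Ioo a b ∧ deriv φ = h := by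
  rcases (tsupport h).eq_empty_or_nonempty with he | hne
  · rw [tsupport_eq_empty_iff] at he
    exact ⟨0, contDiff_const, HasCompactSupport.zero, by simp, by rw [he]; exact deriv_const' 0⟩
  obtain ⟨c, hcm, hcl⟩ := IsCompact.exists_isLeast hc hne
  obtain ⟨d, hdm, hdl⟩ := IsCompact.exists_isGreatest hc hne
  have hac := (hs hcm).1
  have hdb := (hs hdm).2
  let φ : ℝ → ℝ := fun t => ∫ x in a..t, h x
  have hd : ∀ t, HasDerivAt φ (h t) t := fun t =>
    intervalIntegral.integral_hasDerivAt_right (hh.continuous.intervalIntegrable _ _)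
      (hh.continuous.stronglyMeasurableAtFilter _ _) hh.continuous.continuousAt
  have hd' : deriv φ = h := funext fun t => (hd t).deriv
  -- Left of `c` the integrand vanishes; right of `d` the integral is already the total one, zero by
  -- `h0`.
  have hsupp : Function.support φ ⊆ Icc c d := by
    intro t ht
    by_contra hn
    refine ht ?_
    rw [mem_Icc, not_and_or, not_le, not_le] at hn
    rcases hn with hn | hn
    · change ∫ x in a..t, h x = 0
      rw [intervalIntegral.integral_congr (g := fun _ => 0), intervalIntegral.integral_zero]
      intro x hx
      refine image_eq_zero_of_notMem_tsupport fun hx' => ?_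
      have := hcl hx'
      rw [mem_uIcc] at hx
      rcases hx with hx | hx <;> linarith
    · change ∫ x in a..t, h x = 0
      rw [intervalIntegral.integral_eq_integral_of_support_subset, h0]
      intro x hx
      have hx' := subset_tsupport _ hx
      exact ⟨(hs hx').1, (hdl hx').trans hn.le⟩
  have hts : tsupport φ ⊆ Icc c d := closure_minimal hsupp isClosed_Icc
  refine ⟨φ, ?_, isCompact_Icc.of_isClosed_subset (isClosed_tsupport _) hts, fun t ht =>
    ⟨hac.trans_le (hts ht).1, (hts ht).2.trans_lt hdb⟩, hd'⟩
  rw [contDiff_infty_iff_deriv]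
  exact ⟨fun t => (hd t).differentiableAt, by rw [hd']; exact hh⟩

theorem exists_testFunction_integral_eq_one (hab : a < b) :
    ∃ ρ : ℝ → ℝ, ContDiff ℝ ∞ ρ ∧ HasCompactSupport ρ ∧ tsupport ρ ⊆ Ioo a b ∧ ∫ t, ρ t = 1 := by
  let f : ContDiffBump ((a + b) / 2) := ⟨(b - a) / 8, (b - a) / 4, by linarith, by linarith⟩
  refine ⟨f.normed volume, f.contDiff_normed, f.hasCompactSupport_normed, ?_, f.integral_normed⟩
  rw [f.tsupport_normed_eq, Real.closedBall_eq_Icc]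
  intro t ht
  have h1 : (a + b) / 2 - (b - a) / 4 ≤ t := ht.1
  have h2 : t ≤ (a + b) / 2 + (b - a) / 4 := ht.2
  exact ⟨by linarith, by linarith⟩

variable [CompleteSpace E] [CompleteSpace F] [CompleteSpace G]

/-- Integration by parts for primitives of integrable functions, by Fubini's theorem. -/
theorem integral_bilin_primitive (B : E →L[ℝ] F →L[ℝ] G) {f : ℝ → E} {g : ℝ → F}
    (hf : IntegrableOn f (Ioo a b)) (hg : IntegrableOn g (Ioo a b)) :
    IntegrableOn (fun t => B (∫ s in Ioo a t, f s) (g t)) (Ioo a b) ∧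
    ∫ t in Ioo a b, B (∫ s in Ioo a t, f s) (g t)
      = ∫ s in Ioo a b, B (f s) (∫ t in Ioo s b, g t) := by
  set μ := volume.restrict (Ioo a b) with hμ
  -- The integrand on the triangle s < t; the two orders of integration give the two sides.
  let K : ℝ × ℝ → G := {p | p.1 < p.2}.indicator fun p => B (f p.1) (g p.2)
  have hK : Integrable K (μ.prod μ) :=
    (hf.op_fst_snd (op := fun x y => B x y) (by fun_prop) ⟨‖B‖, B.le_opNorm₂⟩ hg).indicator
      (measurableSet_lt measurable_fst measurable_snd)
  have h1 : ∀ t ∈ Ioo a b, ∫ s, K (s, t) ∂μ = B (∫ s in Ioo a t, f s) (g t) := by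
    intro t ht
    have e : (fun s => K (s, t)) = (Iio t).indicator fun s => B (f s) (g t) := rfl
    rw [e, integral_indicator measurableSet_Iio, hμ, Measure.restrict_restrict measurableSet_Iio,
      show Iio t ∩ Ioo a b = Ioo a t by
        ext s; simp only [mem_inter_iff, mem_Iio, mem_Ioo]
        exact ⟨fun h => ⟨h.2.1, h.1⟩, fun h => ⟨h.2, h.1, h.2.trans ht.2⟩⟩]
    exact (B.flip (g t)).integral_comp_comm (hf.mono_set (Ioo_subset_Ioo_right ht.2.le))
  have h2 : ∀ s ∈ Ioo a b, ∫ t, K (s, t) ∂μ = B (f s) (∫ t in Ioo s b, g t) := by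
    intro s hs
    have e : (fun t => K (s, t)) = (Ioi s).indicator fun t => B (f s) (g t) := rfl
    rw [e, integral_indicator measurableSet_Ioi, hμ, Measure.restrict_restrict measurableSet_Ioi,
      show Ioi s ∩ Ioo a b = Ioo s b by
        ext t; simp only [mem_inter_iff, mem_Ioi, mem_Ioo]
        exact ⟨fun h => ⟨h.1, h.2.2⟩, fun h => ⟨h.1, hs.1.trans h.1, h.2⟩⟩]
    exact (B (f s)).integral_comp_comm (hg.mono_set (Ioo_subset_Ioo_left hs.1.le))
  constructor
  · refine (hK.integral_prod_right).congr ?_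
    filter_upwards [ae_restrict_mem measurableSet_Ioo] with t ht
    exact h1 t ht
  · rw [← setIntegral_congr_fun measurableSet_Ioo h1, ← setIntegral_congr_fun measurableSet_Ioo h2]
    exact (integral_integral_swap (f := fun s t => K (s, t)) hK).symm

/-- Here `φ` need not vanish at the ends, so a boundary term survives at `b`; at `a` the primitive
is zero. This term is what later detects boundary values. -/
theorem integral_deriv_smul_primitive {z : ℝ → F} (hz : IntegrableOn z (Ioo a b))
    {φ : ℝ → ℝ} (hφ : ContDiff ℝ ∞ φ) :
    IntegrableOn (fun t => deriv φ t • ∫ s in Ioo a t, z s) (Ioo a b) ∧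
    ∫ t in Ioo a b, deriv φ t • ∫ s in Ioo a t, z s
      = φ b • (∫ s in Ioo a b, z s) - ∫ s in Ioo a b, φ s • z s := by
  have h := integral_bilin_primitive ((ContinuousLinearMap.lsmul ℝ ℝ).flip : F →L[ℝ] ℝ →L[ℝ] F) hz
    (integrableOn_Ioo_of_continuous (hφ.continuous_deriv (by simp)))
  simp only [ContinuousLinearMap.flip_apply, ContinuousLinearMap.lsmul_apply] at h
  refine ⟨h.1, h.2.trans ?_⟩
  rw [← integral_smul]
  refine Eq.trans ?_ (integral_sub (Integrable.smul (φ b) hz)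
    (integrableOn_Ioo_continuous_smul hz hφ.continuous))
  refine setIntegral_congr_fun measurableSet_Ioo fun s hs => ?_
  rw [integral_Ioo_deriv hφ hs.2.le, sub_smul]

/-- The lemma of du Bois-Reymond. -/
theorem ae_eq_const_of_integral_deriv_smul_eq_zero (hab : a < b) {f : ℝ → F}
    (hf : IntegrableOn f (Ioo a b))
    (h : ∀ φ : ℝ → ℝ, ContDiff ℝ ∞ φ → HasCompactSupport φ → tsupport φ ⊆ Ioo a b →
      ∫ t in Ioo a b, deriv φ t • f t = 0) :
    ∃ c, f =ᵐ[volume.restrict (Ioo a b)] fun _ => c := by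
  obtain ⟨ρ, hρ, hρc, hρs, hρ1⟩ := exists_testFunction_integral_eq_one hab
  refine ⟨∫ t in Ioo a b, ρ t • f t, ?_⟩
  set c := ∫ t in Ioo a b, ρ t • f t with hc
  have hint : IntegrableOn (fun t => f t - c) (Ioo a b) :=
    hf.sub (integrableOn_const (by simp))
  have := isOpen_Ioo.ae_eq_zero_of_integral_contDiff_smul_eq_zero (μ := volume)
    hint.locallyIntegrableOn (fun ψ h1 h2 h3 => ?_)
  · rw [← ae_restrict_iff' measurableSet_Ioo] at this
    filter_upwards [this] with t ht
    exact sub_eq_zero.1 ht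
  -- Subtracting (∫ψ)ρ from ψ makes the integral zero, so the difference is the derivative of a test
  -- function. The hypothesis then says that ∫ψf = (∫ψ)c.
  obtain ⟨φ, k1, k2, k3, k4⟩ := exists_testFunction_deriv_eq (a := a) (b := b)
    (h := fun t => ψ t - (∫ s, ψ s) * ρ t) (h1.sub (contDiff_const.mul hρ))
    (h2.sub hρc.mul_left)
    ((tsupport_sub _ _).trans (union_subset h3 ((tsupport_mul_subset_right).trans hρs))) (by
      rw [integral_sub (h1.continuous.integrable_of_hasCompactSupport h2)
        ((hρ.continuous.integrable_of_hasCompactSupport hρc).const_mul _),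
        integral_const_mul, hρ1, mul_one, sub_self])
  have h4 := h φ k1 k2 k3
  rw [k4] at h4
  have i1 := integrableOn_Ioo_continuous_smul hf h1.continuous
  have i2 : IntegrableOn (fun t => (∫ s, ψ s) • ρ t • f t) (Ioo a b) :=
    Integrable.smul (∫ s, ψ s) (integrableOn_Ioo_continuous_smul hf hρ.continuous)
  have i3 : IntegrableOn (fun t => ψ t • c) (Ioo a b) :=
    (integrableOn_Ioo_of_continuous h1.continuous).smul_const c
  have e1 : ∫ t in Ioo a b, ψ t = ∫ t, ψ t := by
    simpa using setIntegral_testFunction_smul h3 (fun _ => (1 : ℝ))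
  rw [← setIntegral_testFunction_smul h3]
  simp only [smul_sub, sub_smul, mul_smul] at h4 ⊢
  rw [integral_sub i1 i2, integral_smul] at h4
  rw [integral_sub i1 i3, integral_smul_const, e1]
  exact h4

end Calculus

/-! ### Weak derivatives on an interval and boundary values -/

section WeakDeriv

variable {d : ℕ} {a b : ℝ} {f f' g g' z : ℝ → EuclideanSpace ℂ (Fin d)}

theorem notMem_tsupport_right {φ : ℝ → ℝ} (h : tsupport φ ⊆ Ioo a b) : φ b = 0 :=
  image_eq_zero_of_notMem_tsupport fun hb => lt_irrefl _ (h hb).2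

theorem isWeakDeriv_const (c : EuclideanSpace ℂ (Fin d)) : IsWeakDeriv a b (fun _ => c) fun _ => 0 := by
  intro φ h1 h2 h3
  simp only [smul_zero, integral_zero, neg_zero, integral_smul_const]
  rcases le_or_gt b a with hab | hab
  · simp [Ioo_eq_empty (not_lt.2 hab)]
  rw [integral_Ioo_deriv h1 hab.le, notMem_tsupport_right h3,
    image_eq_zero_of_notMem_tsupport fun ha => lt_irrefl _ (h3 ha).1, sub_self, zero_smul]

theorem isWeakDeriv_primitive (hz : IntegrableOn z (Ioo a b)) :
    IsWeakDeriv a b (fun t => ∫ s in Ioo a t, z s) z := by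
  intro φ h1 h2 h3
  rw [(integral_deriv_smul_primitive hz h1).2, notMem_tsupport_right h3, zero_smul, zero_sub]

theorem IsWeakDeriv.ae_eq_const_add_primitive (hab : a < b) (h : IsWeakDeriv a b f z)
    (hf : IntegrableOn f (Ioo a b)) (hz : IntegrableOn z (Ioo a b)) :
    ∃ c, f =ᵐ[volume.restrict (Ioo a b)] fun t => c + ∫ s in Ioo a t, z s := by
  have hp : IntegrableOn (fun t => ∫ s in Ioo a t, z s) (Ioo a b) :=
    ((continuousOn_primitive_Ioo hz).integrableOn_Icc).mono_set Ioo_subset_Icc_self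
  obtain ⟨c, hc⟩ := ae_eq_const_of_integral_deriv_smul_eq_zero hab (hf.sub hp) fun φ h1 h2 h3 => by
    simp only [Pi.sub_apply, smul_sub]
    rw [integral_sub (integrableOn_Ioo_continuous_smul hf (h1.continuous_deriv (by simp)))
      (integral_deriv_smul_primitive hz h1).1, h φ h1 h2 h3, isWeakDeriv_primitive hz φ h1 h2 h3,
      sub_self]
  refine ⟨c, ?_⟩
  filter_upwards [hc] with t ht
  rw [← ht, Pi.sub_apply, sub_add_cancel]

/-- `f` is the primitive of `z` vanishing at both ends of the interval. -/
def IsVanishingPrimitive (a b : ℝ) (f z : ℝ → EuclideanSpace ℂ (Fin d)) : Prop :=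
  f =ᵐ[volume.restrict (Ioo a b)] (fun t => ∫ s in Ioo a t, z s) ∧ ∫ s in Ioo a b, z s = 0

/-- The representative c + ∫z is continuous up to the ends, so it agrees there with the one from
`hv`. The zero at `a` gives c = 0, and the zero at `b` gives ∫z = 0. -/
theorem IsWeakDeriv.isVanishingPrimitive (hab : a < b) (h : IsWeakDeriv a b f z)
    (hv : VanishesAtEnds a b f) (hf : IntegrableOn f (Ioo a b)) (hz : IntegrableOn z (Ioo a b)) :
    IsVanishingPrimitive a b f z := by
  obtain ⟨c, hc⟩ := h.ae_eq_const_add_primitive hab hf hz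
  obtain ⟨u, hu, hfu, hua, hub⟩ := hv
  have hcont : ContinuousOn (fun t => c + ∫ s in Ioo a t, z s) (Icc a b) :=
    continuousOn_const.add (continuousOn_primitive_Ioo hz)
  have heq : EqOn u (fun t => c + ∫ s in Ioo a t, z s) (Icc a b) := by
    refine (Measure.eqOn_open_of_ae_eq (hfu.symm.trans hc) isOpen_Ioo
      (hu.mono Ioo_subset_Icc_self) (hcont.mono Ioo_subset_Icc_self)).of_subset_closure hu hcont
      Ioo_subset_Icc_self (closure_Ioo hab.ne).ge
  have ea := heq (left_mem_Icc.2 hab.le)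
  have eb := heq (right_mem_Icc.2 hab.le)
  simp only [Ioo_self, setIntegral_empty, add_zero] at ea
  rw [hua] at ea
  subst ea
  simp only [hub, zero_add] at eb
  simp only [zero_add] at hc
  exact ⟨hc, eb.symm⟩

theorem IsVanishingPrimitive.vanishesAtEnds (h : IsVanishingPrimitive a b f z)
    (hz : IntegrableOn z (Ioo a b)) : VanishesAtEnds a b f :=
  ⟨_, continuousOn_primitive_Ioo hz, h.1, by simp, h.2⟩

/-- Zero boundary values amount to a weak derivative tested against all smooth functions. -/
theorem isWeakDeriv_and_vanishesAtEnds_iff (hab : a < b)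
    (hf : IntegrableOn f (Ioo a b)) (hz : IntegrableOn z (Ioo a b)) :
    (IsWeakDeriv a b f z ∧ VanishesAtEnds a b f) ↔ ∀ φ : ℝ → ℝ, ContDiff ℝ ∞ φ →
      ∫ t in Ioo a b, deriv φ t • f t = - ∫ t in Ioo a b, φ t • z t := by
  constructor
  · rintro ⟨h1, h2⟩ φ hφ
    obtain ⟨h3, h4⟩ := h1.isVanishingPrimitive hab h2 hf hz
    rw [← zero_sub, ← smul_zero (φ b), ← h4, ← (integral_deriv_smul_primitive hz hφ).2]
    refine integral_congr_ae ?_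
    filter_upwards [h3] with t ht
    rw [ht]
  · intro h
    have hw : IsWeakDeriv a b f z := fun φ h1 _ _ => h φ h1
    -- Two test functions suffice for the boundary values: the constant 1 gives ∫z = 0, and the
    -- identity then gives (b - a)c = 0 for the constant in f = c + ∫z.
    have h0 : ∫ s in Ioo a b, z s = 0 := by simpa using h (fun _ => 1) contDiff_const
    obtain ⟨c, hc⟩ := hw.ae_eq_const_add_primitive hab hf hz
    have hp := integral_deriv_smul_primitive hz (contDiff_id (𝕜 := ℝ) (E := ℝ) (n := ∞))
    have h1 := h id contDiff_id
    simp only [deriv_id, one_smul, id] at h1 hp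
    rw [integral_congr_ae hc, integral_add (integrable_const c) hp.1, hp.2, h0, smul_zero,
      zero_sub, add_eq_right] at h1
    have hc0 : c = 0 := by
      simpa [hab.le, sub_eq_zero, hab.ne'] using h1
    subst hc0
    simp only [zero_add] at hc
    exact ⟨hw, IsVanishingPrimitive.vanishesAtEnds ⟨hc, h0⟩ hz⟩

/-- No boundary term appears although only g vanishes at the ends. In f = c + ∫f', the constant
pairs with ∫g' = 0; for the primitive, Fubini produces the integral of g' from t to b, which is
-g(t). -/
theorem IsWeakDeriv.integral_inner (hab : a < b) (hf : IsWeakDeriv a b f f')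
    (hg : IsWeakDeriv a b g g') (hv : VanishesAtEnds a b g)
    (i1 : IntegrableOn f (Ioo a b)) (i2 : IntegrableOn f' (Ioo a b))
    (i3 : IntegrableOn g (Ioo a b)) (i4 : IntegrableOn g' (Ioo a b)) :
    ∫ t in Ioo a b, inner ℂ (f t) (g' t) = - ∫ t in Ioo a b, inner ℂ (f' t) (g t) := by
  obtain ⟨c, hc⟩ := hf.ae_eq_const_add_primitive hab i1 i2
  obtain ⟨hg1, hg2⟩ := hg.isVanishingPrimitive hab hv i3 i4
  let B := (isBoundedBilinearMap_inner (𝕜 := ℂ) (E := EuclideanSpace ℂ (Fin d))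
    ).toContinuousLinearMap
  obtain ⟨j1, j2⟩ := integral_bilin_primitive B i2 i4
  have e1 : ∫ t in Ioo a b, inner ℂ (f t) (g' t) = ∫ t in Ioo a b,
      (inner ℂ c (g' t) + B (∫ s in Ioo a t, f' s) (g' t)) := by
    refine integral_congr_ae ?_
    filter_upwards [hc] with t ht
    rw [ht, inner_add_left]
    rfl
  rw [e1, integral_add (i4.const_inner c) j1, _root_.integral_inner i4, hg2, inner_zero_right, zero_add,
    j2, ← integral_neg]
  refine integral_congr_ae ?_
  filter_upwards [hg1, ae_restrict_mem measurableSet_Ioo] with t ht hm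
  have e2 : ∫ s in Ioo t b, g' s = - g t := by
    rw [ht, eq_neg_iff_add_eq_zero, ← hg2, add_comm]
    simp only [← integral_Ioc_eq_integral_Ioo]
    have i5 : IntegrableOn g' (Ioc a b) := (integrableOn_Ioc_iff_integrableOn_Ioo).2 i4
    rw [← setIntegral_union (Ioc_disjoint_Ioc_of_le le_rfl) measurableSet_Ioc
      (i5.mono_set (Ioc_subset_Ioc_right hm.2.le)) (i5.mono_set (Ioc_subset_Ioc_left hm.1.le)),
      Ioc_union_Ioc_eq_Ioc hm.1.le hm.2.le]
  rw [e2]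
  change inner ℂ (f' t) (-g t) = _
  rw [inner_neg_right]

theorem setIntegral_Ioo_comp_affine {F : Type*} [NormedAddCommGroup F] [NormedSpace ℝ F]
    {c e k l : ℝ} (hab : a ≤ b) (hk : 0 < k)
    (hc : k * a + l = c) (he : k * b + l = e) (h : ℝ → F) :
    ∫ t in Ioo a b, h (k * t + l) = k⁻¹ • ∫ t in Ioo c e, h t := by
  have hce : c ≤ e := by rw [← hc, ← he]; gcongr
  rw [← integral_Ioc_eq_integral_Ioo, ← integral_Ioc_eq_integral_Ioo,
    ← intervalIntegral.integral_of_le hab, ← intervalIntegral.integral_of_le hce,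
    intervalIntegral.integral_comp_mul_add _ hk.ne', hc, he]

/-- Affine change of variables for weak derivatives. -/
theorem IsWeakDeriv.comp_affine {c e k l : ℝ} (hab : a ≤ b) (hk : 0 < k) (hc : k * a + l = c)
    (he : k * b + l = e) (h : IsWeakDeriv c e f g) :
    IsWeakDeriv a b (fun t => f (k * t + l)) fun t => (k : ℂ) • g (k * t + l) := by
  intro φ h1 h2 h3
  let θ : ℝ ≃ₜ ℝ := (Homeomorph.addRight (-l)).trans (Homeomorph.mulLeft₀ k⁻¹ (inv_ne_zero hk.ne'))
  have hθ : ∀ s, θ s = k⁻¹ * (s + -l) := fun s => rfl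
  have hinv : ∀ t, θ (k * t + l) = t := fun t => by rw [hθ]; field_simp; ring
  have hθ' : ∀ s, k * θ s + l = s := fun s => by rw [hθ]; field_simp; ring
  have hd : ∀ s, deriv (φ ∘ θ) s = deriv φ (θ s) * k⁻¹ := fun s => by
    have e1 : HasDerivAt θ k⁻¹ s := by
      have := ((hasDerivAt_id s).add_const (-l)).const_mul k⁻¹
      rw [mul_one] at this
      exact this
    exact ((h1.differentiable (by simp) (θ s)).hasDerivAt.comp s e1).deriv
  have hs : tsupport (φ ∘ θ) ⊆ Ioo c e := by
    rw [tsupport_comp_eq_preimage]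
    intro s hs
    have := h3 hs
    rw [← hc, ← he, ← hθ' s]
    exact ⟨by gcongr; exact this.1, by gcongr; exact this.2⟩
  have h4 := h (φ ∘ θ) (h1.comp (contDiff_const.mul (contDiff_id.add contDiff_const)))
    (h2.comp_homeomorph θ) hs
  have e1 := setIntegral_Ioo_comp_affine hab hk hc he (fun s => deriv φ (θ s) • f s)
  have e2 := setIntegral_Ioo_comp_affine hab hk hc he (fun s => φ (θ s) • (k : ℂ) • g s)
  simp only [hinv] at e1 e2
  rw [e1, e2, ← smul_neg]
  congr 1
  simp only [hd, Function.comp_apply, mul_smul, smul_comm _ k⁻¹, integral_smul] at h4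
  rw [inv_smul_eq_iff₀ hk.ne'] at h4
  rw [h4, smul_neg, ← integral_smul]
  congr 2
  ext1 t
  rw [smul_comm, Complex.coe_smul]

theorem ae_restrict_Ioo_comp_affine {c e k l : ℝ} (hk : 0 < k) (hc : k * a + l = c)
    (he : k * b + l = e) {p : ℝ → Prop} (h : ∀ᵐ t ∂volume.restrict (Ioo c e), p t) :
    ∀ᵐ t ∂volume.restrict (Ioo a b), p (k * t + l) := by
  rw [ae_restrict_iff' measurableSet_Ioo] at h ⊢
  have hq : Measure.QuasiMeasurePreserving (fun t : ℝ => k * t + l) :=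
    ((measurePreserving_add_right volume l).quasiMeasurePreserving).comp
      ⟨measurable_const_mul k, by
        rw [Real.map_volume_mul_left hk.ne']; exact Measure.smul_absolutelyContinuous⟩
  filter_upwards [hq.ae h] with t ht hm
  refine ht ?_
  rw [← hc, ← he]
  exact ⟨by gcongr; exact hm.1, by gcongr; exact hm.2⟩

theorem VanishesAtEnds.comp_affine {c e k l : ℝ} (hk : 0 < k) (hc : k * a + l = c)
    (he : k * b + l = e) (h : VanishesAtEnds c e f) :
    VanishesAtEnds a b (fun t => f (k * t + l)) := by
  obtain ⟨u, hu, hfu, hua, hub⟩ := h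
  refine ⟨fun t => u (k * t + l), hu.comp (by fun_prop) ?_, ae_restrict_Ioo_comp_affine hk hc he hfu,
    by simpa [hc], by simpa [he]⟩
  intro t ht
  rw [← hc, ← he]
  exact ⟨by simpa [hk] using ht.1, by simpa [hk] using ht.2⟩

end WeakDeriv

/-! ### Hilbert sums of isometries -/

section HilbertSum

variable {E : Type*} {V W : E → Type*} [∀ e, NormedAddCommGroup (V e)]
  [∀ e, NormedAddCommGroup (W e)]

theorem memℓp_two_of_norm_le (C : ℝ) (f : lp V 2) {g : ∀ e, W e} (h : ∀ e, ‖g e‖ ≤ C * ‖f e‖) :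
    Memℓp g 2 := by
  have hf := (memℓp_gen_iff (p := 2) (by simp)).1 (lp.memℓp f)
  refine memℓp_gen ?_
  simp only [ENNReal.toReal_ofNat, Real.rpow_ofNat] at hf ⊢
  refine Summable.of_nonneg_of_le (fun _ => by positivity) (fun e => ?_) (hf.mul_left (C ^ 2))
  rw [← mul_pow]
  exact pow_le_pow_left₀ (norm_nonneg _) (h e) 2

variable [∀ e, NormedSpace ℂ (V e)] [∀ e, NormedSpace ℂ (W e)]

/-- The direct sum of a family of isometries. -/
noncomputable def lpMapIsometry (J : ∀ e, V e →ₗᵢ[ℂ] W e) : lp V 2 →ₗᵢ[ℂ] lp W 2 where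
  toFun f := ⟨fun e => J e (f e), memℓp_two_of_norm_le 1 f fun e => by simp⟩
  map_add' f g := by ext e; exact map_add (J e) (f e) (g e)
  map_smul' c f := by ext e; exact map_smul (J e) c (f e)
  norm_map' f := by
    rw [lp.norm_eq_tsum_rpow (by simp), lp.norm_eq_tsum_rpow (by simp)]
    simp

/-- Isometries preserve the norms of edgewise preimages, so these are again square summable. -/
theorem mem_range_lpMapIsometry {J : ∀ e, V e →ₗᵢ[ℂ] W e} {g : lp W 2} :
    g ∈ LinearMap.range (lpMapIsometry J).toLinearMap ↔
      ∀ e, g e ∈ LinearMap.range (J e).toLinearMap := by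
  constructor
  · rintro ⟨f, rfl⟩ e
    exact ⟨f e, rfl⟩
  · intro h
    choose f hf using h
    refine ⟨⟨f, memℓp_two_of_norm_le 1 g fun e => ?_⟩, ?_⟩
    · rw [← hf e, one_mul]
      exact ((J e).norm_map _).ge
    · ext e
      exact hf e

end HilbertSum

/-! ### Matrices and test vectors on a single edge -/

section Edge

variable {d : ℕ} {a b w : ℝ}

/-- A matrix as a bounded operator. -/
noncomputable def matL (M : Matrix (Fin d) (Fin d) ℂ) :
    EuclideanSpace ℂ (Fin d) →L[ℂ] EuclideanSpace ℂ (Fin d) :=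
  LinearMap.toContinuousLinearMap (Matrix.toEuclideanLin M)

theorem matL_apply (M : Matrix (Fin d) (Fin d) ℂ) (v : EuclideanSpace ℂ (Fin d)) :
    matL M v = Matrix.toEuclideanLin M v := rfl

theorem matL_mul_apply (M N : Matrix (Fin d) (Fin d) ℂ) (v : EuclideanSpace ℂ (Fin d)) :
    matL (M * N) v = matL M (matL N v) := by
  simp only [matL_apply, Matrix.toEuclideanLin, Matrix.toLpLin_mul_same]
  rfl

theorem matL_one_apply (v : EuclideanSpace ℂ (Fin d)) : matL 1 v = v := by
  simp only [matL_apply, Matrix.toEuclideanLin, Matrix.toLpLin_one]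
  rfl

theorem matL_inv_apply {P : Matrix (Fin d) (Fin d) ℂ} (hP : IsUnit P)
    (v : EuclideanSpace ℂ (Fin d)) : matL P⁻¹ (matL P v) = v := by
  rw [← matL_mul_apply, Matrix.nonsing_inv_mul _ ((Matrix.isUnit_iff_isUnit_det _).1 hP),
    matL_one_apply]

theorem matL_apply_inv {P : Matrix (Fin d) (Fin d) ℂ} (hP : IsUnit P)
    (v : EuclideanSpace ℂ (Fin d)) : matL P (matL P⁻¹ v) = v := by
  rw [← matL_mul_apply, Matrix.mul_nonsing_inv _ ((Matrix.isUnit_iff_isUnit_det _).1 hP),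
    matL_one_apply]

theorem inner_matL_left {P : Matrix (Fin d) (Fin d) ℂ} (hP : P.IsHermitian)
    (u v : EuclideanSpace ℂ (Fin d)) : inner ℂ (matL P u) v = inner ℂ u (matL P v) :=
  Matrix.isSymmetric_toEuclideanLin_iff.2 hP u v

theorem IsWeakDeriv.map (M : EuclideanSpace ℂ (Fin d) →L[ℂ] EuclideanSpace ℂ (Fin d))
    {f g : ℝ → EuclideanSpace ℂ (Fin d)} (h : IsWeakDeriv a b f g)
    (hf : IntegrableOn f (Ioo a b)) (hg : IntegrableOn g (Ioo a b)) :
    IsWeakDeriv a b (fun t => M (f t)) fun t => M (g t) := by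
  intro φ h1 h2 h3
  have key : ∀ (ψ : ℝ → ℝ) (q : ℝ → EuclideanSpace ℂ (Fin d)), Continuous ψ →
      IntegrableOn q (Ioo a b) →
      ∫ t in Ioo a b, ψ t • M (q t) = M (∫ t in Ioo a b, ψ t • q t) := by
    intro ψ q hψ hq
    rw [← M.integral_comp_comm (integrableOn_Ioo_continuous_smul hq hψ)]
    refine integral_congr_ae (Eventually.of_forall fun t => ?_)
    exact (M.map_smul_of_tower (ψ t) (q t)).symm
  rw [key _ _ (h1.continuous_deriv (by simp)) hf, key _ _ h1.continuous hg, h φ h1 h2 h3, map_neg]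

instance isFiniteMeasure_edgeMeasure : IsFiniteMeasure (edgeMeasure a b w) := by
  unfold edgeMeasure
  exact Measure.smul_finite _ ENNReal.ofReal_ne_top

theorem integral_edgeMeasure {G : Type*} [NormedAddCommGroup G] [NormedSpace ℝ G] (hw : 0 < w)
    (f : ℝ → G) : ∫ t, f t ∂edgeMeasure a b w = w • ∫ t in Ioo a b, f t := by
  rw [edgeMeasure, integral_smul_measure, ENNReal.toReal_ofReal hw.le]

theorem memLp_continuous_smul {φ : ℝ → ℝ} (hφ : Continuous φ) (v : EuclideanSpace ℂ (Fin d)) :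
    MemLp (fun t => φ t • v) 2 (edgeMeasure a b w) := by
  obtain ⟨C, hC⟩ := isCompact_Icc.exists_bound_of_continuousOn (s := Icc a b)
    (hφ.smul continuous_const : Continuous fun t => φ t • v).continuousOn
  refine MemLp.of_bound (hφ.smul continuous_const).aestronglyMeasurable C (ae_edgeMeasure ?_)
  filter_upwards [ae_restrict_mem measurableSet_Ioo] with t ht
  exact hC t (Ioo_subset_Icc_self ht)

/-- The function `φ ⊗ v` as an element of `L²_w(a, b)`. -/
noncomputable def testVec (a b w : ℝ) {φ : ℝ → ℝ} (hφ : Continuous φ)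
    (v : EuclideanSpace ℂ (Fin d)) : EdgeL2 d a b w :=
  (memLp_continuous_smul hφ v).toLp _

theorem coeFn_testVec (hw : 0 < w) {φ : ℝ → ℝ} (hφ : Continuous φ)
    (v : EuclideanSpace ℂ (Fin d)) :
    testVec a b w hφ v =ᵐ[volume.restrict (Ioo a b)] fun t => φ t • v :=
  ae_of_ae_edgeMeasure hw (MemLp.coeFn_toLp _)

theorem EdgeL2.inner_eq (hw : 0 < w) (f g : EdgeL2 d a b w) :
    inner ℂ f g = w • ∫ t in Ioo a b, inner ℂ (f t) (g t) := by
  rw [L2.inner_def, integral_edgeMeasure hw]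

theorem inner_testVec (hw : 0 < w) {φ : ℝ → ℝ} (hφ : Continuous φ)
    (v : EuclideanSpace ℂ (Fin d)) (f : EdgeL2 d a b w) :
    inner ℂ (testVec a b w hφ v) f = w • inner ℂ v (∫ t in Ioo a b, φ t • f t) := by
  rw [EdgeL2.inner_eq hw,
    ← integral_inner (integrableOn_Ioo_continuous_smul (EdgeL2.integrableOn hw f) hφ)]
  congr 1
  refine integral_congr_ae ?_
  filter_upwards [coeFn_testVec hw hφ v] with t ht
  rw [ht, ← Complex.coe_smul, ← Complex.coe_smul, inner_smul_left, inner_smul_right,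
    Complex.conj_ofReal]

/-- A matrix applied to an element of `L²_w(a, b)`. -/
noncomputable def EdgeL2.mat (M : Matrix (Fin d) (Fin d) ℂ) (f : EdgeL2 d a b w) :
    EdgeL2 d a b w := (matL M).compLp f

theorem EdgeL2.coeFn_mat (hw : 0 < w) (M : Matrix (Fin d) (Fin d) ℂ) (f : EdgeL2 d a b w) :
    EdgeL2.mat M f =ᵐ[volume.restrict (Ioo a b)] fun t => matL M (f t) :=
  ae_of_ae_edgeMeasure hw ((matL M).coeFn_compLp f)

theorem EdgeL2.norm_mat_le (M : Matrix (Fin d) (Fin d) ℂ) (f : EdgeL2 d a b w) :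
    ‖EdgeL2.mat M f‖ ≤ ‖matL M‖ * ‖f‖ := (matL M).norm_compLp_le f

theorem EdgeL2.ext_ae {f g : EdgeL2 d a b w}
    (h : f =ᵐ[volume.restrict (Ioo a b)] g) : f = g :=
  Lp.ext (ae_edgeMeasure h)

theorem EdgeL2.coeFn_neg (hw : 0 < w) (f : EdgeL2 d a b w) :
    (-f : EdgeL2 d a b w) =ᵐ[volume.restrict (Ioo a b)] fun t => -f t :=
  ae_of_ae_edgeMeasure hw (Lp.coeFn_neg f)

theorem EdgeL2.coeFn_zero (hw : 0 < w) :
    (0 : EdgeL2 d a b w) =ᵐ[volume.restrict (Ioo a b)] fun _ => 0 :=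
  ae_of_ae_edgeMeasure hw (Lp.coeFn_zero _ _ _)

/-- The pairs `(f, g)` with `(w P₁ f)' = g` weakly. -/
theorem isWeakDeriv_mat_iff {P₁ : Matrix (Fin d) (Fin d) ℂ} (hPu : IsUnit P₁) (hw : 0 < w)
    (f g : EdgeL2 d a b w) :
    IsWeakDeriv a b (fun t => matL P₁ ((w : ℂ) • f t)) g ↔
      ∃ z : EdgeL2 d a b w, IsWeakDeriv a b (fun t => (w : ℂ) • f t) z ∧
        g =ᵐ[volume.restrict (Ioo a b)] fun t => matL P₁ (z t) := by
  have i1 : IntegrableOn (fun t => (w : ℂ) • f t) (Ioo a b) :=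
    Integrable.smul (w : ℂ) (EdgeL2.integrableOn hw f)
  constructor
  · intro h
    -- A constant matrix commutes with weak differentiation, so applying the inverse of `P₁`
    -- isolates the derivative of w f.
    have h1 := h.map (matL P₁⁻¹) ((matL P₁).integrable_comp i1) (EdgeL2.integrableOn hw g)
    simp only [matL_inv_apply hPu] at h1
    refine ⟨EdgeL2.mat P₁⁻¹ g, h1.congr (EventuallyEq.refl _ _) (EdgeL2.coeFn_mat hw _ _), ?_⟩
    filter_upwards [EdgeL2.coeFn_mat hw P₁⁻¹ g] with t ht
    rw [ht, matL_apply_inv hPu]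
  · rintro ⟨z, hz, hg⟩
    exact (hz.map (matL P₁) i1 (EdgeL2.integrableOn hw z)).congr (EventuallyEq.refl _ _) hg

theorem integral_smul_matL {P₁ : Matrix (Fin d) (Fin d) ℂ} (hw : 0 < w) {φ : ℝ → ℝ}
    (hφ : Continuous φ) (f : EdgeL2 d a b w) :
    ∫ t in Ioo a b, φ t • matL P₁ ((w : ℂ) • f t)
      = w • matL P₁ (∫ t in Ioo a b, φ t • f t) := by
  rw [← (matL P₁).integral_comp_comm
    (integrableOn_Ioo_continuous_smul (EdgeL2.integrableOn hw f) hφ), ← integral_smul]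
  congr 1
  ext1 t
  rw [Complex.coe_smul, ContinuousLinearMap.map_smul_of_tower,
    ContinuousLinearMap.map_smul_of_tower, smul_comm]

end Edge

/-! ### The minimal operator on the network: density, adjoint, skew-symmetry, closedness -/

section Network

variable {d : ℕ} {E : Type*} {P₁ : Matrix (Fin d) (Fin d) ℂ} {a b : E → ℝ}
  {w : E → {r : ℝ // 0 < r}}

theorem isWeakDeriv_of_hasDerivAt {a b : ℝ} {f f' : ℝ → EuclideanSpace ℂ (Fin d)}
    (h : ∀ t, HasDerivAt f (f' t) t) (hf' : Continuous f') : IsWeakDeriv a b f f' := by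
  have hi : IntegrableOn f' (Ioo a b) := integrableOn_Ioo_of_continuous hf'
  have h2 := (isWeakDeriv_primitive hi).add (isWeakDeriv_const (f a))
    (((continuousOn_primitive_Ioo hi).integrableOn_Icc).mono_set Ioo_subset_Icc_self)
    (integrableOn_Ioo_of_continuous continuous_const) hi
    (integrableOn_Ioo_of_continuous continuous_const)
  refine h2.congr ?_ ?_
  · filter_upwards [ae_restrict_mem measurableSet_Ioo] with t ht
    rw [← integral_Ioc_eq_integral_Ioo, ← intervalIntegral.integral_of_le ht.1.le,
      intervalIntegral.integral_eq_sub_of_hasDerivAt (fun x _ => h x)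
      (hf'.intervalIntegrable _ _), sub_add_cancel]
  · simp

theorem isWeakDeriv_testFunction {a b : ℝ} {φ : ℝ → ℝ} (hφ : ContDiff ℝ ∞ φ)
    (v : EuclideanSpace ℂ (Fin d)) :
    IsWeakDeriv a b (fun t => φ t • v) fun t => deriv φ t • v :=
  isWeakDeriv_of_hasDerivAt
    (fun t => ((hφ.differentiable (by simp) t).hasDerivAt).smul_const v)
    ((hφ.continuous_deriv (by simp)).smul continuous_const)

/-- Test functions supported on one edge belong to the domain. They are enough to prove density and
to compute the adjoint edge by edge. -/
theorem single_mem_netGraph [DecidableEq E] {e : E} {φ : ℝ → ℝ}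
    (hφ : ContDiff ℝ ∞ φ) (hs : tsupport φ ⊆ Ioo (a e) (b e)) (v : EuclideanSpace ℂ (Fin d)) :
    (lp.single 2 e (testVec (a e) (b e) (w e) hφ.continuous v),
      ((w e : ℝ) : ℂ) • lp.single 2 e (testVec (a e) (b e) (w e)
        (hφ.continuous_deriv (by simp)) (matL P₁ v))) ∈ netGraph P₁ a b w := by
  have hd : Continuous (deriv φ) := hφ.continuous_deriv (by simp)
  have hsm : ∀ u : EuclideanSpace ℂ (Fin d),
      (((w e : ℝ) : ℂ) • testVec (a e) (b e) (w e) hd u : EdgeL2 d (a e) (b e) (w e))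
        =ᵐ[volume.restrict (Ioo (a e) (b e))] fun t => ((w e : ℝ) : ℂ) • deriv φ t • u := by
    intro u
    filter_upwards [ae_of_ae_edgeMeasure (w e).2 (Lp.coeFn_smul ((w e : ℝ) : ℂ)
      (testVec (a e) (b e) (w e) hd u)), coeFn_testVec (w e).2 hd u] with t h1 h2
    rw [h1, Pi.smul_apply, h2]
  refine ⟨((w e : ℝ) : ℂ) • lp.single 2 e (testVec (a e) (b e) (w e) hd v), fun e' => ?_⟩
  by_cases he : e' = e
  · subst he
    simp only [lp.coeFn_smul, Pi.smul_apply, lp.single_apply_self]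
    refine ⟨?_, ?_, ?_⟩
    · refine (((isWeakDeriv_testFunction hφ v).smul ((w e' : ℝ) : ℂ))).congr ?_ (hsm v)
      filter_upwards [coeFn_testVec (w e').2 hφ.continuous v] with t ht
      rw [ht]
    · refine ⟨fun t => ((w e' : ℝ) : ℂ) • φ t • v, by have := hφ.continuous; fun_prop, ?_, ?_, ?_⟩
      · filter_upwards [coeFn_testVec (w e').2 hφ.continuous v] with t ht
        rw [ht]
      · simp [image_eq_zero_of_notMem_tsupport fun ha => lt_irrefl _ (hs ha).1]
      · simp [notMem_tsupport_right hs]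
    · filter_upwards [hsm v, hsm (matL P₁ v)] with t h1 h2
      rw [h1, h2, ← matL_apply, map_smul, ContinuousLinearMap.map_smul_of_tower]
  · have h0 := EdgeL2.coeFn_zero (d := d) (a := a e') (b := b e') (w e').2
    simp only [lp.coeFn_smul, Pi.smul_apply, lp.single_apply_ne _ _ _ he, smul_zero]
    have hf : (fun t => ((w e' : ℝ) : ℂ) • (0 : EdgeL2 d (a e') (b e') (w e')) t)
        =ᵐ[volume.restrict (Ioo (a e') (b e'))] fun _ => 0 := by
      filter_upwards [h0] with t ht
      rw [ht, smul_zero]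
    refine ⟨(isWeakDeriv_zero _ _).congr hf h0, ⟨fun _ => 0, continuousOn_const, hf, rfl, rfl⟩, ?_⟩
    filter_upwards [h0] with t ht
    rw [ht, map_zero]

theorem dense_netOp_domain :
    Dense ((netOp P₁ a b w).domain : Set (NetL2 d a b fun e => (w e : ℝ))) := by
  classical
  rw [Submodule.dense_iff_topologicalClosure_eq_top, Submodule.topologicalClosure_eq_top_iff,
    Submodule.eq_bot_iff]
  intro y hy
  ext1
  funext e
  refine EdgeL2.ext_ae (EventuallyEq.trans ?_ (EdgeL2.coeFn_zero (w e).2).symm)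
  refine (ae_restrict_iff' measurableSet_Ioo).2
    (isOpen_Ioo.ae_eq_zero_of_integral_contDiff_smul_eq_zero (μ := volume)
      (EdgeL2.integrableOn (w e).2 (y e)).locallyIntegrableOn fun φ h1 _ h3 => ?_)
  rw [← setIntegral_testFunction_smul h3]
  refine ext_inner_left ℂ fun v => ?_
  have hm := single_mem_netGraph (P₁ := P₁) (w := w) h1 h3 v
  rw [← netOp_graph] at hm
  have h := (Submodule.mem_orthogonal _ _).1 hy _ (LinearPMap.mem_domain_of_mem_graph hm)
  rw [lp.inner_single_left, inner_testVec (w e).2] at h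
  rw [inner_zero_right]
  exact (smul_eq_zero.1 h).resolve_left (w e).2.ne'

/-- The adjoint of the minimal operator is `y ↦ -(P₁ (w e y e)')_e` without boundary conditions. -/
theorem mem_adjoint_netOp_graph_iff (hab : ∀ e, a e < b e) (hP : P₁.IsHermitian)
    {y v : NetL2 d a b fun e => (w e : ℝ)} :
    (y, v) ∈ (netOp P₁ a b w).adjoint.graph ↔ ∀ e, IsWeakDeriv (a e) (b e)
      (fun t => matL P₁ (((w e : ℝ) : ℂ) • y e t)) (-v e : EdgeL2 d (a e) (b e) (w e)) := by
  classical
  rw [mem_adjoint_graph_iff dense_netOp_domain, netOp_graph]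
  constructor
  · intro h e φ h1 h2 h3
    have hd : Continuous (deriv φ) := h1.continuous_deriv (by simp)
    rw [integral_smul_matL (w e).2 hd]
    refine ext_inner_left ℂ fun u => ?_
    -- Pairing with φ ⊗ u on the single edge e recovers the weak equation; the weight of the inner
    -- product cancels.
    have hh := h _ (single_mem_netGraph h1 h3 u)
    simp only at hh
    rw [inner_smul_left, lp.inner_single_left, lp.inner_single_left, inner_testVec (w e).2,
      inner_testVec (w e).2, Complex.conj_ofReal, inner_matL_left hP, ← smul_eq_mul,
      Complex.coe_smul, smul_right_inj (w e).2.ne'] at hh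
    have e1 : ∫ t in Ioo (a e) (b e), φ t • (-v e : EdgeL2 d (a e) (b e) (w e)) t
        = - ∫ t in Ioo (a e) (b e), φ t • v e t := by
      rw [← integral_neg]
      refine integral_congr_ae ?_
      filter_upwards [EdgeL2.coeFn_neg (w e).2 (v e)] with t ht
      rw [ht, smul_neg]
    rw [e1, neg_neg, ← Complex.coe_smul, inner_smul_right, ← smul_eq_mul, Complex.coe_smul]
    exact hh.symm
  · rintro h ⟨x, x'⟩ ⟨z, hz⟩
    simp only at hz ⊢
    rw [lp.inner_eq_tsum, lp.inner_eq_tsum]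
    congr 1
    ext1 e
    obtain ⟨hz1, hz2, hz3⟩ := hz e
    have hw := (w e).2
    rw [EdgeL2.inner_eq hw, EdgeL2.inner_eq hw]
    have i1 : ∀ f : EdgeL2 d (a e) (b e) (w e),
        IntegrableOn (fun t => ((w e : ℝ) : ℂ) • f t) (Ioo (a e) (b e)) :=
      fun f => Integrable.smul ((w e : ℝ) : ℂ) (EdgeL2.integrableOn hw f)
    -- The element x of the minimal domain vanishes at both ends, so y needs no boundary condition.
    have key := (h e).integral_inner (hab e) hz1 hz2 ((matL P₁).integrable_comp (i1 (y e)))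
      (EdgeL2.integrableOn hw _) (i1 (x e)) (EdgeL2.integrableOn hw _)
    have k1 : ∫ t in Ioo (a e) (b e), inner ℂ (matL P₁ (((w e : ℝ) : ℂ) • y e t)) (z e t)
        = ((w e : ℝ) : ℂ) * starRingEnd ℂ (∫ t in Ioo (a e) (b e), inner ℂ (x' e t) (y e t)) := by
      rw [← integral_conj, ← integral_const_mul]
      refine integral_congr_ae ?_
      filter_upwards [hz3] with t ht
      rw [ht, inner_conj_symm, inner_matL_left hP, inner_smul_left, Complex.conj_ofReal]
      rfl
    have k2 : ∫ t in Ioo (a e) (b e), inner ℂ ((-v e : EdgeL2 d (a e) (b e) (w e)) t)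
          (((w e : ℝ) : ℂ) • x e t)
        = - (((w e : ℝ) : ℂ) *
          starRingEnd ℂ (∫ t in Ioo (a e) (b e), inner ℂ (x e t) (v e t))) := by
      rw [← integral_conj, ← integral_const_mul, ← integral_neg]
      refine integral_congr_ae ?_
      filter_upwards [EdgeL2.coeFn_neg hw (v e)] with t ht
      rw [ht, inner_conj_symm, inner_smul_right, inner_neg_left, mul_neg]
    rw [k1, k2, neg_neg] at key
    have hw' : ((w e : ℝ) : ℂ) ≠ 0 := by exact_mod_cast hw.ne'
    rw [(starRingEnd ℂ).injective (mul_left_cancel₀ hw' key)]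

/-- Forgetting the boundary conditions shows that -A⋆ extends A. -/
theorem isSkewSymmetric_netOp (hab : ∀ e, a e < b e) (hP : P₁.IsHermitian) (hPu : IsUnit P₁) :
    IsSkewSymmetric (netOp P₁ a b w) := by
  rintro ⟨x, x'⟩ hx q hq
  have h : (x, -x') ∈ (netOp P₁ a b w).adjoint.graph := by
    rw [mem_adjoint_netOp_graph_iff hab hP]
    rw [netOp_graph] at hx
    obtain ⟨z, hz⟩ := hx
    intro e
    obtain ⟨hz1, -, hz3⟩ := hz e
    rw [show -(-x' : NetL2 d a b fun e => (w e : ℝ)) e = x' e from neg_neg (x' e)]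
    exact (isWeakDeriv_mat_iff hPu (w e).2 _ _).2 ⟨z e, hz1, hz3⟩
  have := (mem_adjoint_graph_iff dense_netOp_domain).1 h q hq
  simp only [inner_neg_right] at this
  rw [← inner_conj_symm, ← neg_neg (inner ℂ q.1 x'), this, map_neg, inner_conj_symm]

/-- Testing with all smooth functions, not only those of compact support, encodes the boundary
conditions as well. Each condition is then an equation between continuous functions of `p`, so the
graph is an intersection of closed sets. -/
theorem mem_netGraph_iff (hab : ∀ e, a e < b e) (hP : P₁.IsHermitian) (hPu : IsUnit P₁)
    {p : NetL2 d a b (fun e => (w e : ℝ)) × NetL2 d a b (fun e => (w e : ℝ))} :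
    p ∈ netGraph P₁ a b w ↔ ∀ e (φ : ℝ → ℝ) (hφ : ContDiff ℝ ∞ φ) (v : EuclideanSpace ℂ (Fin d)),
      (w e : ℝ) • inner ℂ (testVec (a e) (b e) (w e) (hφ.continuous_deriv (by simp)) (matL P₁ v))
        (p.1 e) = - inner ℂ (testVec (a e) (b e) (w e) hφ.continuous v) (p.2 e) := by
  have i1 : ∀ e (f : EdgeL2 d (a e) (b e) (w e)),
      IntegrableOn (fun t => ((w e : ℝ) : ℂ) • f t) (Ioo (a e) (b e)) :=
    fun e f => Integrable.smul ((w e : ℝ) : ℂ) (EdgeL2.integrableOn (w e).2 f)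
  have key : ∀ (z : NetL2 d a b (fun e => (w e : ℝ))),
      (∀ e, p.2 e =ᵐ[volume.restrict (Ioo (a e) (b e))] fun t => matL P₁ (z e t)) →
      ∀ e (φ : ℝ → ℝ) (hφ : ContDiff ℝ ∞ φ),
      (∫ t in Ioo (a e) (b e), deriv φ t • ((w e : ℝ) : ℂ) • p.1 e t
        = - ∫ t in Ioo (a e) (b e), φ t • z e t) ↔ ∀ (v : EuclideanSpace ℂ (Fin d)),
      (w e : ℝ) • inner ℂ (testVec (a e) (b e) (w e) (hφ.continuous_deriv (by simp)) (matL P₁ v))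
        (p.1 e) = - inner ℂ (testVec (a e) (b e) (w e) hφ.continuous v) (p.2 e) := by
    intro z hz e φ hφ
    have e1 : ∫ t in Ioo (a e) (b e), deriv φ t • ((w e : ℝ) : ℂ) • p.1 e t
        = (w e : ℝ) • ∫ t in Ioo (a e) (b e), deriv φ t • p.1 e t := by
      rw [← integral_smul]
      congr 1
      ext1 t
      rw [Complex.coe_smul, smul_comm]
    have e2 : ∫ t in Ioo (a e) (b e), φ t • p.2 e t
        = matL P₁ (∫ t in Ioo (a e) (b e), φ t • z e t) := by
      rw [← (matL P₁).integral_comp_comm (integrableOn_Ioo_continuous_smul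
        (EdgeL2.integrableOn (w e).2 (z e)) hφ.continuous)]
      refine integral_congr_ae ?_
      filter_upwards [hz e] with t ht
      rw [ht, ContinuousLinearMap.map_smul_of_tower]
    rw [e1]
    constructor
    · intro h v
      rw [inner_testVec (w e).2, inner_testVec (w e).2, e2, ← inner_matL_left hP, ← smul_neg,
        ← inner_neg_right, ← h, ← Complex.coe_smul (w e : ℝ) (∫ t in _, _), inner_smul_right,
        ← smul_eq_mul, Complex.coe_smul]
    · intro h
      refine ext_inner_left ℂ fun u => ?_
      have := h (matL P₁⁻¹ u)
      rw [inner_testVec (w e).2, inner_testVec (w e).2, e2, ← inner_matL_left hP,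
        matL_apply_inv hPu, ← smul_neg, smul_right_inj (w e).2.ne'] at this
      rw [← Complex.coe_smul, inner_smul_right, inner_neg_right, ← this, ← smul_eq_mul,
        Complex.coe_smul]
  constructor
  · rintro ⟨z, hz⟩ e φ hφ
    refine (key z (fun e => (hz e).2.2) e φ hφ).1 ?_
    exact (isWeakDeriv_and_vanishesAtEnds_iff (hab e) (i1 e (p.1 e))
      (EdgeL2.integrableOn (w e).2 (z e))).1 ⟨(hz e).1, (hz e).2.1⟩ φ hφ
  · intro h
    -- The derivative must be the inverse of `P₁` applied to the second component. It is square
    -- summable over the edges because the same matrix acts on all of them.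
    let z : NetL2 d a b (fun e => (w e : ℝ)) := ⟨fun e => EdgeL2.mat P₁⁻¹ (p.2 e),
      memℓp_two_of_norm_le ‖matL P₁⁻¹‖ p.2 fun e => EdgeL2.norm_mat_le _ _⟩
    have hz : ∀ e, p.2 e =ᵐ[volume.restrict (Ioo (a e) (b e))] fun t => matL P₁ (z e t) := by
      intro e
      filter_upwards [EdgeL2.coeFn_mat (w e).2 P₁⁻¹ (p.2 e)] with t ht
      change _ = matL P₁ (EdgeL2.mat P₁⁻¹ (p.2 e) t)
      rw [ht, matL_apply_inv hPu]
    refine ⟨z, fun e => ?_⟩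
    have := (isWeakDeriv_and_vanishesAtEnds_iff (hab e) (i1 e (p.1 e))
      (EdgeL2.integrableOn (w e).2 (z e))).2 fun φ hφ => (key z hz e φ hφ).2 (h e φ hφ)
    exact ⟨this.1, this.2, hz e⟩

theorem continuous_netL2_apply (e : E) :
    Continuous fun x : NetL2 d a b (fun e => (w e : ℝ)) => x e := by
  refine LipschitzWith.continuous (K := 1) (LipschitzWith.of_dist_le_mul fun x y => ?_)
  rw [NNReal.coe_one, one_mul, dist_eq_norm, dist_eq_norm]
  exact lp.norm_apply_le_norm (by simp) (x - y) e

theorem isClosed_netOp (hab : ∀ e, a e < b e) (hP : P₁.IsHermitian) (hPu : IsUnit P₁) :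
    (netOp P₁ a b w).IsClosed := by
  rw [LinearPMap.IsClosed, netOp_graph]
  have : (netGraph P₁ a b w : Set (NetL2 d a b (fun e => (w e : ℝ)) ×
      NetL2 d a b (fun e => (w e : ℝ)))) = ⋂ (e) (φ : ℝ → ℝ) (hφ : ContDiff ℝ ∞ φ)
      (v : EuclideanSpace ℂ (Fin d)), {p | (w e : ℝ) • inner ℂ (testVec (a e) (b e) (w e)
        (hφ.continuous_deriv (by simp)) (matL P₁ v)) (p.1 e)
          = - inner ℂ (testVec (a e) (b e) (w e) hφ.continuous v) (p.2 e)} := by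
    ext p
    simp only [mem_iInter]
    exact mem_netGraph_iff hab hP hPu
  rw [this]
  have hc₁ : ∀ e, Continuous fun p : NetL2 d a b (fun e => (w e : ℝ)) ×
      NetL2 d a b (fun e => (w e : ℝ)) => p.1 e :=
    fun e => (continuous_netL2_apply e).comp continuous_fst
  have hc₂ : ∀ e, Continuous fun p : NetL2 d a b (fun e => (w e : ℝ)) ×
      NetL2 d a b (fun e => (w e : ℝ)) => p.2 e :=
    fun e => (continuous_netL2_apply e).comp continuous_snd
  refine isClosed_iInter fun e => isClosed_iInter fun φ => isClosed_iInter fun hφ =>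
    isClosed_iInter fun v => isClosed_eq ?_ ?_
  · exact Continuous.const_smul (Continuous.inner (𝕜 := ℂ) continuous_const (hc₁ e)) (w e : ℝ)
  · exact (Continuous.inner (𝕜 := ℂ) continuous_const (hc₂ e)).neg

end Network

/-! ### Edge kernels spanned by normalized exponentials -/

section Kernel

variable {d : ℕ} {σ w : ℝ} {P₁ S : Matrix (Fin d) (Fin d) ℂ} {m : Fin d → ℝ}

theorem EdgeL2.norm_sq_eq {a b w : ℝ} (hw : 0 < w) (f : EdgeL2 d a b w) :
    ‖f‖ ^ 2 = w * ∫ t in Ioo a b, ‖f t‖ ^ 2 := by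
  have h := EdgeL2.inner_eq hw f f
  rw [inner_self_eq_norm_sq_to_K] at h
  simp only [inner_self_eq_norm_sq_to_K] at h
  have e : ∫ t in Ioo a b, ((‖f t‖ : ℝ) : ℂ) ^ 2 = ((∫ t in Ioo a b, ‖f t‖ ^ 2 : ℝ) : ℂ) := by
    have := integral_ofReal (𝕜 := ℂ) (μ := volume.restrict (Ioo a b)) (f := fun t => ‖f t‖ ^ 2)
    simpa using this
  simp only [Complex.coe_algebraMap] at h
  rw [e, Complex.real_smul] at h
  exact_mod_cast h

/-- A real diagonal matrix as a bounded operator. -/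
noncomputable def diagL (c : Fin d → ℝ) : EuclideanSpace ℂ (Fin d) →L[ℂ] EuclideanSpace ℂ (Fin d) :=
  matL (Matrix.diagonal fun k => (c k : ℂ))

theorem diagL_apply (c : Fin d → ℝ) (v : EuclideanSpace ℂ (Fin d)) (k : Fin d) :
    diagL c v k = c k * v k := by
  simp [diagL, matL_apply, Matrix.toLpLin_apply, Matrix.mulVec_diagonal]

theorem diagL_diagL (c c' : Fin d → ℝ) (v : EuclideanSpace ℂ (Fin d)) :
    diagL c (diagL c' v) = diagL (fun k => c k * c' k) v := by
  ext k
  simp only [diagL_apply]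
  push_cast
  ring

theorem diagL_const (c : ℝ) (v : EuclideanSpace ℂ (Fin d)) :
    diagL (fun _ => c) v = (c : ℂ) • v := by
  ext k
  simp [diagL_apply]

theorem matL_conjTranspose_matL (hS : S ∈ Matrix.unitaryGroup (Fin d) ℂ)
    (v : EuclideanSpace ℂ (Fin d)) : matL Sᴴ (matL S v) = v := by
  rw [← matL_mul_apply, ← Matrix.star_eq_conjTranspose, Matrix.mem_unitaryGroup_iff'.1 hS,
    matL_one_apply]

theorem matL_matL_conjTranspose (hS : S ∈ Matrix.unitaryGroup (Fin d) ℂ)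
    (v : EuclideanSpace ℂ (Fin d)) : matL S (matL Sᴴ v) = v := by
  rw [← matL_mul_apply, ← Matrix.star_eq_conjTranspose, Matrix.mem_unitaryGroup_iff.1 hS,
    matL_one_apply]

theorem norm_matL_conjTranspose (hS : S ∈ Matrix.unitaryGroup (Fin d) ℂ)
    (v : EuclideanSpace ℂ (Fin d)) : ‖matL Sᴴ v‖ = ‖v‖ := by
  have h : inner ℂ (matL Sᴴ v) (matL Sᴴ v) = inner ℂ v v := by
    nth_rw 1 [matL_apply]
    rw [Matrix.toEuclideanLin_conjTranspose_eq_adjoint, LinearMap.adjoint_inner_left,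
      ← matL_apply, matL_matL_conjTranspose hS]
  rw [@norm_eq_sqrt_re_inner ℂ, @norm_eq_sqrt_re_inner ℂ, h]

theorem diag_ne_zero_of_isUnit (hPu : IsUnit P₁)
    (hPS : P₁ = Sᴴ * Matrix.diagonal (fun k => (m k : ℂ)) * S) (k : Fin d) : m k ≠ 0 := by
  intro hk
  have h := (Matrix.isUnit_iff_isUnit_det _).1 hPu
  rw [hPS, Matrix.det_mul, Matrix.det_mul, Matrix.det_diagonal,
    Finset.prod_eq_zero (Finset.mem_univ k) (by simp [hk])] at h
  simp at h

theorem expNorm_sq (hσ : σ ^ 2 = 1) {μ : ℝ} (hμ : μ ≠ 0) :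
    ∫ t in Ioo (0 : ℝ) 1, Real.exp (-(σ / μ) * t) ^ 2 = expNorm σ μ ^ 2 ∧ 0 < expNorm σ μ := by
  have hσ0 : σ ≠ 0 := by rintro rfl; norm_num at hσ
  have h0 : -(2 * σ) / μ ≠ 0 := by
    simp [hσ0, hμ]
  have e1 : ∫ t in Ioo (0 : ℝ) 1, Real.exp (-(σ / μ) * t) ^ 2
      = -σ * (μ / 2) * (Real.exp (-(2 * σ) / μ) - 1) := by
    have : ∀ t, Real.exp (-(σ / μ) * t) ^ 2 = Real.exp (-(2 * σ) / μ * t) := fun t => by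
      rw [← Real.exp_nat_mul]; congr 1; push_cast; ring
    simp only [this]
    rw [← integral_Ioc_eq_integral_Ioo, ← intervalIntegral.integral_of_le zero_le_one,
      intervalIntegral.integral_comp_mul_left (fun x => Real.exp x) h0, integral_exp, smul_eq_mul]
    have : (-(2 * σ) / μ)⁻¹ = -σ * (μ / 2) := by
      field_simp
      linarith
    rw [this]
    simp
  have hpos : 0 < ∫ t in Ioo (0 : ℝ) 1, Real.exp (-(σ / μ) * t) ^ 2 := by
    rw [← integral_Ioc_eq_integral_Ioo, ← intervalIntegral.integral_of_le zero_le_one]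
    exact intervalIntegral.intervalIntegral_pos_of_pos
      (Continuous.intervalIntegrable (by fun_prop) _ _) (fun t => by positivity) zero_lt_one
  rw [e1] at hpos ⊢
  exact ⟨(Real.sq_sqrt hpos.le).symm, Real.sqrt_pos.2 hpos⟩

/-- The normalized exponential `t ↦ e^{-σ t / (w μ)}` in `L²_w(0, 1)`. -/
noncomputable def expFun (σ w μ t : ℝ) : ℝ :=
  Real.exp (-(σ / (w * μ)) * t) / (√w * expNorm σ (w * μ))

theorem hasDerivAt_expFun (σ w μ t : ℝ) :
    HasDerivAt (expFun σ w μ) (-(σ / (w * μ)) * expFun σ w μ t) t := by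
  have h : HasDerivAt (fun t => Real.exp (-(σ / (w * μ)) * t))
      (Real.exp (-(σ / (w * μ)) * t) * (-(σ / (w * μ)) * 1)) t :=
    ((hasDerivAt_id t).const_mul _).exp
  refine (h.div_const (√w * expNorm σ (w * μ))).congr_deriv ?_
  rw [expFun]
  ring

theorem continuous_expFun (σ w μ : ℝ) : Continuous (expFun σ w μ) :=
  continuous_iff_continuousAt.2 fun t => (hasDerivAt_expFun σ w μ t).continuousAt

theorem integral_expFun_sq (hσ : σ ^ 2 = 1) (hw : 0 < w) {μ : ℝ} (hμ : μ ≠ 0) :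
    w * ∫ t in Ioo (0 : ℝ) 1, expFun σ w μ t ^ 2 = 1 := by
  obtain ⟨h1, h2⟩ := expNorm_sq hσ (mul_ne_zero hw.ne' hμ)
  simp only [expFun, div_pow]
  rw [integral_div, h1, mul_pow, Real.sq_sqrt hw.le]
  field_simp

/-- The solution of `u + σ w P₁ u' = 0` with coordinates `v` in the orthonormal basis of
exponentials. -/
noncomputable def edgeSol (σ w : ℝ) (S : Matrix (Fin d) (Fin d) ℂ) (m : Fin d → ℝ)
    (v : EuclideanSpace ℂ (Fin d)) (t : ℝ) : EuclideanSpace ℂ (Fin d) :=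
  matL Sᴴ (diagL (fun k => expFun σ w (m k) t) v)

theorem hasDerivAt_diagL {c : ℝ → Fin d → ℝ} {c' : Fin d → ℝ} {t : ℝ}
    (h : ∀ k, HasDerivAt (fun s => c s k) (c' k) t) (v : EuclideanSpace ℂ (Fin d)) :
    HasDerivAt (fun s => diagL (c s) v) (diagL c' v) t := by
  rw [← hasDerivWithinAt_univ, hasDerivWithinAt_iff_hasFDerivWithinAt, hasFDerivWithinAt_piLp 2]
  intro k
  simp only [diagL_apply]
  refine ((((h k).ofReal_comp).mul_const (v k)).hasDerivWithinAt.hasFDerivWithinAt).congr_fderiv ?_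
  ext
  simp [diagL_apply]

theorem hasDerivAt_edgeSol (σ w : ℝ) (S : Matrix (Fin d) (Fin d) ℂ) (m : Fin d → ℝ)
    (v : EuclideanSpace ℂ (Fin d)) (t : ℝ) :
    HasDerivAt (edgeSol σ w S m v)
      (edgeSol σ w S m (diagL (fun k => -(σ / (w * m k))) v) t) t := by
  have h := hasDerivAt_diagL (fun k => hasDerivAt_expFun σ w (m k) t) v
  refine (((matL Sᴴ).restrictScalars ℝ).hasFDerivAt.comp_hasDerivAt t h).congr_deriv ?_
  rw [edgeSol, diagL_diagL]
  simp only [mul_comm]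
  rfl

theorem continuous_edgeSol (σ w : ℝ) (S : Matrix (Fin d) (Fin d) ℂ) (m : Fin d → ℝ)
    (v : EuclideanSpace ℂ (Fin d)) : Continuous (edgeSol σ w S m v) :=
  continuous_iff_continuousAt.2 fun t => (hasDerivAt_edgeSol σ w S m v t).continuousAt

/-- In the coordinates given by `S`, `P₁` multiplies by m_k, cancelling the m_k in the logarithmic
derivative -σ/(w m_k) of the exponential. -/
theorem matL_edgeSol (hS : S ∈ Matrix.unitaryGroup (Fin d) ℂ)
    (hPS : P₁ = Sᴴ * Matrix.diagonal (fun k => (m k : ℂ)) * S) (hm : ∀ k, m k ≠ 0)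
    (v : EuclideanSpace ℂ (Fin d)) (t : ℝ) :
    matL P₁ (edgeSol σ w S m (diagL (fun k => -(σ / (w * m k))) v) t)
      = ((-(σ / w) : ℝ) : ℂ) • edgeSol σ w S m v t := by
  rw [hPS, edgeSol, edgeSol, matL_mul_apply, matL_matL_conjTranspose hS, matL_mul_apply,
    ← diagL, diagL_diagL, diagL_diagL, ← map_smul, ← diagL_const, diagL_diagL]
  congr 3
  ext k
  have := hm k
  field_simp

theorem memLp_edgeSol (v : EuclideanSpace ℂ (Fin d)) :
    MemLp (edgeSol σ w S m v) 2 (edgeMeasure 0 1 w) := by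
  have hc := continuous_edgeSol σ w S m v
  obtain ⟨C, hC⟩ := isCompact_Icc.exists_bound_of_continuousOn (s := Icc (0 : ℝ) 1) hc.continuousOn
  refine MemLp.of_bound hc.aestronglyMeasurable C (ae_edgeMeasure ?_)
  filter_upwards [ae_restrict_mem measurableSet_Ioo] with t ht
  exact hC t (Ioo_subset_Icc_self ht)

/-- `Sᴴ` preserves norms, so the integral splits into coordinates, each carrying a normalized
exponential. -/
theorem integral_norm_edgeSol_sq (hσ : σ ^ 2 = 1) (hw : 0 < w)
    (hS : S ∈ Matrix.unitaryGroup (Fin d) ℂ) (hm : ∀ k, m k ≠ 0) (v : EuclideanSpace ℂ (Fin d)) :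
    w * ∫ t in Ioo (0 : ℝ) 1, ‖edgeSol σ w S m v t‖ ^ 2 = ‖v‖ ^ 2 := by
  have e : ∀ t, ‖edgeSol σ w S m v t‖ ^ 2 = ∑ k, expFun σ w (m k) t ^ 2 * ‖v k‖ ^ 2 := fun t => by
    rw [edgeSol, norm_matL_conjTranspose hS, EuclideanSpace.norm_sq_eq]
    refine Finset.sum_congr rfl fun k _ => ?_
    rw [diagL_apply, norm_mul, mul_pow, Complex.norm_real, Real.norm_eq_abs, sq_abs]
  simp only [e]
  have hi : ∀ k ∈ Finset.univ, IntegrableOn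
      (fun t => expFun σ w (m k) t ^ 2 * ‖v k‖ ^ 2) (Ioo (0 : ℝ) 1) := fun k _ =>
    integrableOn_Ioo_of_continuous (((continuous_expFun σ w (m k)).pow 2).mul continuous_const)
  rw [integral_finsetSum _ hi, Finset.mul_sum,
    EuclideanSpace.norm_sq_eq]
  refine Finset.sum_congr rfl fun k _ => ?_
  rw [integral_mul_const, ← mul_assoc, integral_expFun_sq hσ hw (hm k), one_mul]

/-- The coordinates of `ker (1 + σ [∂ (w P₁)])` in the orthonormal basis of exponentials. -/
noncomputable def edgeKerIsometry (hσ : σ ^ 2 = 1) (hw : 0 < w)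
    (hS : S ∈ Matrix.unitaryGroup (Fin d) ℂ) (hm : ∀ k, m k ≠ 0) :
    EuclideanSpace ℂ (Fin d) →ₗᵢ[ℂ] EdgeL2 d 0 1 w where
  toFun v := (memLp_edgeSol (σ := σ) (S := S) (m := m) v).toLp _
  map_add' u v := by
    rw [← MemLp.toLp_add]
    congr 1
    ext1 t
    simp [edgeSol]
  map_smul' c v := by
    rw [RingHom.id_apply, ← MemLp.toLp_const_smul]
    congr 1
    ext1 t
    simp [edgeSol]
  norm_map' v := by
    refine (sq_eq_sq₀ (norm_nonneg _) (norm_nonneg _)).1 ?_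
    change ‖(memLp_edgeSol (σ := σ) (S := S) (m := m) v).toLp _‖ ^ 2 = _
    rw [EdgeL2.norm_sq_eq hw, ← integral_norm_edgeSol_sq hσ hw hS hm v]
    congr 1
    refine integral_congr_ae ?_
    filter_upwards [ae_of_ae_edgeMeasure hw
      (MemLp.coeFn_toLp (memLp_edgeSol (σ := σ) (S := S) (m := m) v))] with t ht
    rw [ht]

theorem coeFn_edgeKerIsometry (hσ : σ ^ 2 = 1) (hw : 0 < w)
    (hS : S ∈ Matrix.unitaryGroup (Fin d) ℂ) (hm : ∀ k, m k ≠ 0) (v : EuclideanSpace ℂ (Fin d)) :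
    edgeKerIsometry hσ hw hS hm v =ᵐ[volume.restrict (Ioo 0 1)] edgeSol σ w S m v :=
  ae_of_ae_edgeMeasure hw (MemLp.coeFn_toLp (memLp_edgeSol v))

/-- As σ² = 1, multiplication by σ turns f + σP₁z = 0 into P₁z = -σf. This is the form in which A⋆x
= σx reads on each edge. -/
theorem memEdgeKer_iff (hσ : σ ^ 2 = 1) (hw : 0 < w) (hPu : IsUnit P₁) (f : EdgeL2 d 0 1 w) :
    MemEdgeKer σ P₁ w f ↔ IsWeakDeriv 0 1 (fun t => matL P₁ ((w : ℂ) • f t))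
      (-((σ : ℂ) • f) : EdgeL2 d 0 1 w) := by
  have hσ' : (σ : ℂ) * σ = 1 := by exact_mod_cast (sq σ).symm.trans hσ
  have hsm : (-((σ : ℂ) • f) : EdgeL2 d 0 1 w) =ᵐ[volume.restrict (Ioo 0 1)]
      fun t => -((σ : ℂ) • f t) := by
    filter_upwards [EdgeL2.coeFn_neg hw ((σ : ℂ) • f),
      ae_of_ae_edgeMeasure hw (Lp.coeFn_smul (σ : ℂ) f)] with t h1 h2
    rw [h1, h2, Pi.smul_apply]
  rw [isWeakDeriv_mat_iff hPu hw, MemEdgeKer]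
  refine exists_congr fun z => and_congr_right fun _ => ⟨fun h => ?_, fun h => ?_⟩
  · filter_upwards [h, hsm] with t h1 h2
    rw [h2, eq_neg_of_add_eq_zero_left h1, smul_neg, neg_neg, smul_smul, hσ', one_smul, matL_apply]
  · filter_upwards [h, hsm] with t h1 h2
    rw [← matL_apply, ← h1, h2, smul_neg, smul_smul, hσ', one_smul, add_neg_cancel]

theorem IsWeakDeriv.integral_coord {a b : ℝ} {f g : ℝ → EuclideanSpace ℂ (Fin d)}
    (h : IsWeakDeriv a b f g) (hf : IntegrableOn f (Ioo a b)) (hg : IntegrableOn g (Ioo a b))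
    (k : Fin d) {φ : ℝ → ℝ} (h1 : ContDiff ℝ ∞ φ) (h2 : HasCompactSupport φ)
    (h3 : tsupport φ ⊆ Ioo a b) :
    ∫ t in Ioo a b, deriv φ t • f t k = - ∫ t in Ioo a b, φ t • g t k := by
  have key : ∀ (ψ : ℝ → ℝ) (q : ℝ → EuclideanSpace ℂ (Fin d)), Continuous ψ →
      IntegrableOn q (Ioo a b) →
      ∫ t in Ioo a b, ψ t • q t k = (∫ t in Ioo a b, ψ t • q t) k := by
    intro ψ q hψ hq
    exact (EuclideanSpace.proj (𝕜 := ℂ) k).integral_comp_comm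
      (integrableOn_Ioo_continuous_smul hq hψ)
  rw [key _ _ (h1.continuous_deriv (by simp)) hf, key _ _ h1.continuous hg, h φ h1 h2 h3]
  rfl

/-- Weak solutions of the scalar equation `μ f' = -f` are exponentials. -/
theorem ae_eq_exp_of_integral_eq {a b μ : ℝ} (hab : a < b) (hμ : μ ≠ 0) {f : ℝ → ℂ}
    (hf : IntegrableOn f (Ioo a b))
    (h : ∀ φ : ℝ → ℝ, ContDiff ℝ ∞ φ → HasCompactSupport φ → tsupport φ ⊆ Ioo a b →
      μ • ∫ t in Ioo a b, deriv φ t • f t = ∫ t in Ioo a b, φ t • f t) :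
    ∃ c : ℂ, f =ᵐ[volume.restrict (Ioo a b)] fun t => Real.exp (-μ⁻¹ * t) • c := by
  have hE : ContDiff ℝ ∞ fun t => Real.exp (μ⁻¹ * t) := by fun_prop
  -- The integrating factor e^{t/μ} is put into the test function; e^{t/μ} f then has zero weak
  -- derivative and is constant.
  obtain ⟨c, hc⟩ := ae_eq_const_of_integral_deriv_smul_eq_zero hab
    (integrableOn_Ioo_continuous_smul hf hE.continuous) fun ψ h1 h2 h3 => by
    have h4 := h (fun t => ψ t * Real.exp (μ⁻¹ * t)) (h1.mul hE) h2.mul_right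
      ((tsupport_mul_subset_left).trans h3)
    have hd : ∀ t, deriv (fun t => ψ t * Real.exp (μ⁻¹ * t)) t
        = deriv ψ t * Real.exp (μ⁻¹ * t) + μ⁻¹ * (ψ t * Real.exp (μ⁻¹ * t)) := fun t => by
      have e2 : HasDerivAt (fun t => Real.exp (μ⁻¹ * t)) (Real.exp (μ⁻¹ * t) * (μ⁻¹ * 1)) t :=
        ((hasDerivAt_id t).const_mul _).exp
      refine (((h1.differentiable (by simp) t).hasDerivAt).mul e2).deriv.trans ?_
      ring
    simp only [hd, add_smul] at h4
    have j1 : IntegrableOn (fun t => (deriv ψ t * Real.exp (μ⁻¹ * t)) • f t) (Ioo a b) :=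
      integrableOn_Ioo_continuous_smul hf ((h1.continuous_deriv (by simp)).mul hE.continuous)
    have j2 : IntegrableOn (fun t => (μ⁻¹ * (ψ t * Real.exp (μ⁻¹ * t))) • f t) (Ioo a b) :=
      integrableOn_Ioo_continuous_smul hf
        (continuous_const.mul (h1.continuous.mul hE.continuous))
    rw [integral_add j1 j2] at h4
    simp only [mul_smul μ⁻¹, integral_smul] at h4
    rw [smul_add, smul_inv_smul₀ hμ, add_eq_right] at h4
    simpa only [smul_smul] using (smul_eq_zero.1 h4).resolve_left hμ
  refine ⟨c, ?_⟩
  filter_upwards [hc] with t ht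
  rw [← ht, smul_smul, ← Real.exp_add]
  simp

/-- Applying `S` decouples the system into the scalar equations σ w m_k f_k' = -f_k, whose weak
solutions are exactly the multiples of one exponential. -/
theorem mem_range_edgeKerIsometry (hσ : σ ^ 2 = 1) (hw : 0 < w) (hPu : IsUnit P₁)
    (hS : S ∈ Matrix.unitaryGroup (Fin d) ℂ) (hm : ∀ k, m k ≠ 0)
    (hPS : P₁ = Sᴴ * Matrix.diagonal (fun k => (m k : ℂ)) * S) (f : EdgeL2 d 0 1 w) :
    f ∈ LinearMap.range (edgeKerIsometry hσ hw hS hm).toLinearMap ↔ MemEdgeKer σ P₁ w f := by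
  have hsm : ∀ f : EdgeL2 d 0 1 w, (-((σ : ℂ) • f) : EdgeL2 d 0 1 w) =ᵐ[volume.restrict (Ioo 0 1)]
      fun t => -((σ : ℂ) • f t) := fun f => by
    filter_upwards [EdgeL2.coeFn_neg hw ((σ : ℂ) • f),
      ae_of_ae_edgeMeasure hw (Lp.coeFn_smul (σ : ℂ) f)] with t h1 h2
    rw [h1, h2, Pi.smul_apply]
  rw [memEdgeKer_iff hσ hw hPu]
  constructor
  · rintro ⟨v, rfl⟩
    have hc := coeFn_edgeKerIsometry hσ hw hS hm v
    have hi : ∀ u, IntegrableOn (fun t => (w : ℂ) • edgeSol σ w S m u t) (Ioo 0 1) := fun u =>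
      integrableOn_Ioo_of_continuous ((continuous_edgeSol σ w S m u).const_smul (w : ℂ))
    have h := ((isWeakDeriv_of_hasDerivAt (a := 0) (b := 1) (hasDerivAt_edgeSol σ w S m v)
      (continuous_edgeSol _ _ _ _ _)).smul (w : ℂ)).map (matL P₁) (hi _) (hi _)
    refine h.congr ?_ ?_
    · filter_upwards [hc] with t ht
      exact congrArg (fun u => matL P₁ ((w : ℂ) • u)) ht
    · filter_upwards [hc, hsm (edgeKerIsometry hσ hw hS hm v)] with t h1 h2
      refine h2.trans ?_
      rw [h1, map_smul, matL_edgeSol hS hPS hm, smul_smul, ← neg_smul]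
      congr 1
      push_cast
      have : (w : ℂ) ≠ 0 := by exact_mod_cast hw.ne'
      field_simp
  · intro h
    have hfi := EdgeL2.integrableOn hw f
    have i1 : IntegrableOn (fun t => matL P₁ ((w : ℂ) • f t)) (Ioo 0 1) :=
      (matL P₁).integrable_comp (Integrable.smul (w : ℂ) hfi)
    have h1 := h.map (matL S) i1 (EdgeL2.integrableOn hw _)
    have i2 : IntegrableOn (fun t => matL S (matL P₁ ((w : ℂ) • f t))) (Ioo 0 1) :=
      (matL S).integrable_comp i1
    have i3 : IntegrableOn (fun t => matL S ((-((σ : ℂ) • f) : EdgeL2 d 0 1 w) t)) (Ioo 0 1) :=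
      (matL S).integrable_comp (EdgeL2.integrableOn hw _)
    have hσ' : σ * σ = 1 := (sq σ).symm.trans hσ
    have hex : ∀ k, ∃ c : ℂ, (fun t => matL S (f t) k) =ᵐ[volume.restrict (Ioo 0 1)]
        fun t => Real.exp (-(σ * (w * m k))⁻¹ * t) • c := by
      intro k
      have hσ0 : σ ≠ 0 := left_ne_zero_of_mul_eq_one hσ'
      refine ae_eq_exp_of_integral_eq zero_lt_one (mul_ne_zero hσ0 (mul_ne_zero hw.ne' (hm k)))
        ((EuclideanSpace.proj (𝕜 := ℂ) k).integrable_comp ((matL S).integrable_comp hfi)) ?_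
      intro φ q1 q2 q3
      have h2 := h1.integral_coord i2 i3 k q1 q2 q3
      have e1 : ∀ t, matL S (matL P₁ ((w : ℂ) • f t)) k = (w * m k) • matL S (f t) k := fun t => by
        rw [hPS, mul_assoc, matL_mul_apply, matL_matL_conjTranspose hS, matL_mul_apply,
          ← diagL, diagL_apply, map_smul, PiLp.smul_apply, Complex.real_smul]
        push_cast
        simp only [smul_eq_mul]
        ring
      have e2 : ∫ t in Ioo (0 : ℝ) 1, φ t • matL S ((-((σ : ℂ) • f) : EdgeL2 d 0 1 w) t) k
          = -(σ • ∫ t in Ioo (0 : ℝ) 1, φ t • matL S (f t) k) := by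
        rw [← integral_smul, ← integral_neg]
        refine integral_congr_ae ?_
        filter_upwards [hsm f] with t ht
        rw [ht, map_neg, map_smul, PiLp.neg_apply, PiLp.smul_apply, smul_neg, smul_comm,
          Complex.coe_smul]
      simp only [e1, smul_comm _ (w * m k), integral_smul] at h2
      rw [e2, neg_neg] at h2
      rw [mul_smul, h2, smul_smul, hσ', one_smul]
    choose c hc using hex
    -- The coordinates carry the normalizing constants by which `expFun` divides.
    refine ⟨WithLp.toLp 2 fun k => ((√w * expNorm σ (w * m k) : ℝ) : ℂ) * c k, ?_⟩
    refine EdgeL2.ext_ae ?_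
    filter_upwards [coeFn_edgeKerIsometry hσ hw hS hm
      (WithLp.toLp 2 fun k => ((√w * expNorm σ (w * m k) : ℝ) : ℂ) * c k),
      ae_all_iff.2 hc] with t h3 h4
    refine h3.trans ?_
    rw [← matL_conjTranspose_matL hS (f t), edgeSol]
    congr 1
    ext k
    rw [h4 k, diagL_apply, expFun, Complex.real_smul]
    have hne : √w * expNorm σ (w * m k) ≠ 0 :=
      (mul_pos (Real.sqrt_pos.2 hw) (expNorm_sq hσ (mul_ne_zero hw.ne' (hm k))).2).ne'
    have hs : σ / (w * m k) = (σ * (w * m k))⁻¹ := by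
      have := hm k
      have : σ ≠ 0 := left_ne_zero_of_mul_eq_one hσ'
      field_simp
      exact hσ
    rw [← mul_assoc, ← Complex.ofReal_mul, div_mul_cancel₀ _ hne, hs]

/-- The coordinate vector `v` gives functions on `(0, 1)` which are rescalings of each other. -/
theorem isEdgeRescaling_edgeSol (hσ : σ ^ 2 = 1) {α : ℝ} (hα : 0 < α)
    (hS : S ∈ Matrix.unitaryGroup (Fin d) ℂ) (hm : ∀ k, m k ≠ 0)
    (hPS : P₁ = Sᴴ * Matrix.diagonal (fun k => (m k : ℂ)) * S) (v : EuclideanSpace ℂ (Fin d)) :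
    IsEdgeRescaling σ α P₁ S m
      (edgeKerIsometry hσ (one_div_pos.2 hα) hS hm v) (edgeKerIsometry hσ one_pos hS hm v) := by
  refine ⟨edgeSol σ (1 / α) S m v,
    fun t => (hasDerivAt_edgeSol _ _ _ _ _ t).differentiableAt, fun t => ?_,
    coeFn_edgeKerIsometry hσ _ hS hm v, ?_⟩
  · rw [(hasDerivAt_edgeSol _ _ _ _ _ t).deriv, ← matL_apply, matL_edgeSol hS hPS hm, smul_smul,
      ← Complex.ofReal_mul]
    have : σ / α * -(σ / (1 / α)) = -1 := by
      field_simp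
      rw [hσ]
    rw [this]
    simp
  · filter_upwards [coeFn_edgeKerIsometry hσ one_pos hS hm v] with t ht
    rw [ht, ← matL_apply, edgeSol, edgeSol, matL_mul_apply, matL_matL_conjTranspose hS,
      matL_mul_apply, ← diagL, diagL_diagL]
    congr 3
    ext k
    have h1 := (expNorm_sq hσ (hm k)).2
    have h2 := (expNorm_sq hσ (div_ne_zero (hm k) hα.ne')).2
    have h3 := hm k
    simp only [expFun, one_mul, Real.sqrt_one]
    -- At t/α the exponential for weight 1/α has the exponent -σt/m_k of weight 1, so only the ratio
    -- of normalizing constants is left; it is the diagonal entry of the rescaling.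
    have e1 : 1 / α * m k = m k / α := by ring
    have e2 : -(σ / (m k / α)) * (t / α) = -(σ / m k) * t := by field_simp
    have e3 : √(1 / α) = 1 / √α := by rw [Real.sqrt_div zero_le_one, Real.sqrt_one]
    have h4 := Real.sqrt_pos.2 hα
    rw [e1, e2, e3]
    field_simp

end Kernel

/-! ### Maximal dissipativity through boundary maps; transport of adjoints -/

section BoundaryMaps

variable {X : Type*} [NormedAddCommGroup X] [InnerProductSpace ℂ X] [CompleteSpace X]
  {G₁ G₂ : Type*} [NormedAddCommGroup G₁] [InnerProductSpace ℂ G₁] [CompleteSpace G₁]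
  [NormedAddCommGroup G₂] [InnerProductSpace ℂ G₂] [CompleteSpace G₂]

/-- Maximal dissipative operators between `A` and `-A⋆` in terms of boundary maps for `A⋆`. -/
theorem isMaximalDissipative_iff_of_boundaryMaps {A H : X →ₗ.[ℂ] X}
    (hA : Dense (A.domain : Set X)) (F₁ : A.adjoint.domain →ₗ[ℂ] G₁)
    (F₂ : A.adjoint.domain →ₗ[ℂ] G₂) (hsurj : ∀ g₁ g₂, ∃ x, F₁ x = g₁ ∧ F₂ x = g₂)
    (hform : ∀ x : A.adjoint.domain,
      2 * (inner ℂ (A.adjoint x) (x : X)).re = ‖F₁ x‖ ^ 2 - ‖F₂ x‖ ^ 2)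
    (hAH : A ≤ H) (hHA : H ≤ -A.adjoint) :
    (IsMaximalDissipative H ↔ ∃ T : G₁ →L[ℂ] G₂, ‖T‖ ≤ 1 ∧
      ∀ x, x ∈ H.domain ↔ ∃ hx : x ∈ A.adjoint.domain, T (F₁ ⟨x, hx⟩) = F₂ ⟨x, hx⟩) ∧
    (IsMaximalDissipative (-H) ↔ ∃ T : G₂ →L[ℂ] G₁, ‖T‖ ≤ 1 ∧
      ∀ x, x ∈ H.domain ↔ ∃ hx : x ∈ A.adjoint.domain, T (F₂ ⟨x, hx⟩) = F₁ ⟨x, hx⟩) := by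
  have hs : IsSkewSymmetric A := isSkewSymmetric_of_le_neg_adjoint hA (hAH.trans hHA)
  have hre : ∀ p ∈ A.graph, (inner ℂ p.2 p.1).re = 0 := by
    rintro ⟨x, x'⟩ hp
    obtain ⟨y, rfl, rfl⟩ := (LinearPMap.mem_graph_iff A).1 hp
    exact hs.re_inner_eq_zero y
  constructor
  -- For `H` the ambient operator is -A⋆. A dissipative K extending H also extends A, and Re⟨Ax, x⟩
  -- = 0, so `IsDissipative.inner_eq_neg` applies to each x ∈ D(A) and puts K below -A⋆.
  · refine isMaximalDissipative_iff_exists_contraction (-A.adjoint) H F₁ F₂ hsurj (fun x => ?_)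
      hHA fun K hK hHK => ?_
    · have := hform x
      rw [LinearPMap.neg_apply, inner_neg_left, Complex.neg_re]
      linarith
    · have hAK := LinearPMap.le_graph_of_le (hAH.trans hHK)
      have hy : ∀ y : K.domain, ((y : X), -K y) ∈ A.adjoint.graph := by
        intro y
        rw [mem_adjoint_graph_iff hA]
        rintro ⟨p, p'⟩ hp
        obtain ⟨x, rfl, rfl⟩ := (LinearPMap.mem_graph_iff K).1 (hAK hp)
        have h := hK.inner_eq_neg x y (hre _ hp)
        simp only
        rw [inner_neg_right, ← inner_conj_symm, h, map_neg, inner_conj_symm, neg_neg]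
      have hle : K.domain ≤ A.adjoint.domain := fun y hyK =>
        LinearPMap.mem_domain_of_mem_graph (hy ⟨y, hyK⟩)
      refine ⟨hle, fun y z hyz => ?_⟩
      have h := LinearPMap.mem_graph_snd_inj _ (hy y) (A.adjoint.mem_graph z) hyz
      rw [LinearPMap.neg_apply, ← h, neg_neg]
  -- For -H the ambient operator is A⋆; its form has the opposite sign, so the boundary maps are
  -- exchanged.
  · refine isMaximalDissipative_iff_exists_contraction A.adjoint (-H) F₂ F₁
      (fun g₂ g₁ => (hsurj g₁ g₂).imp fun _ h => h.symm) hform ?_ fun K hK hHK => ?_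
    · refine ⟨hHA.1, fun y z hyz => ?_⟩
      rw [LinearPMap.neg_apply, hHA.2 (x := y) (y := z) hyz, LinearPMap.neg_apply, neg_neg]
    · have hAK : ∀ p ∈ A.graph, (p.1, -p.2) ∈ K.graph := by
        rintro ⟨x, x'⟩ hp
        obtain ⟨y, rfl, rfl⟩ := (LinearPMap.mem_graph_iff H).1 (LinearPMap.le_graph_of_le hAH hp)
        exact LinearPMap.le_graph_of_le hHK ((-H).mem_graph y)
      have hy : ∀ y : K.domain, ((y : X), K y) ∈ A.adjoint.graph := by
        intro y
        rw [mem_adjoint_graph_iff hA]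
        rintro ⟨p, p'⟩ hp
        obtain ⟨x, hx, hx'⟩ := (LinearPMap.mem_graph_iff K).1 (hAK _ hp)
        simp only at hx hx'
        have h := hK.inner_eq_neg x y (by
          rw [hx, hx', inner_neg_left, Complex.neg_re, hre _ hp, neg_zero])
        simp only
        rw [← hx, ← inner_conj_symm, h, hx', inner_neg_right, neg_neg, inner_conj_symm]
      refine ⟨fun y hyK => LinearPMap.mem_domain_of_mem_graph (hy ⟨y, hyK⟩), fun y z hyz => ?_⟩
      exact LinearPMap.mem_graph_snd_inj _ (hy y) (A.adjoint.mem_graph z) hyz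

/-- Unitary equivalence of operators carries over to their adjoints. -/
theorem symm_mem_adjoint_graph {Y : Type*} [NormedAddCommGroup Y] [InnerProductSpace ℂ Y]
    [CompleteSpace Y] {A : X →ₗ.[ℂ] X} {B : Y →ₗ.[ℂ] Y} (hA : Dense (A.domain : Set X))
    (hB : Dense (B.domain : Set Y)) (U : X ≃ₗᵢ[ℂ] Y)
    (h : ∀ p ∈ A.graph, (U p.1, U p.2) ∈ B.graph) {y v : Y} (hy : (y, v) ∈ B.adjoint.graph) :
    (U.symm y, U.symm v) ∈ A.adjoint.graph := by
  rw [mem_adjoint_graph_iff hA]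
  intro p hp
  have := (mem_adjoint_graph_iff hB).1 hy _ (h p hp)
  rw [← U.inner_map_map, ← U.inner_map_map, U.apply_symm_apply, U.apply_symm_apply]
  exact this

end BoundaryMaps

/-! ### Affine rescaling of the edges -/

section Rescaling

variable {d : ℕ}

theorem map_affine_restrict_Ioo {a b c e k l : ℝ} (hk : 0 < k) (hc : k * a + l = c)
    (he : k * b + l = e) :
    Measure.map (fun t => k * t + l) (volume.restrict (Ioo a b))
      = ENNReal.ofReal k⁻¹ • volume.restrict (Ioo c e) := by
  have hpre : Ioo a b = (fun t => k * t + l) ⁻¹' Ioo c e := by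
    ext t
    simp [← hc, ← he, hk]
  have hmeas : Measurable fun t : ℝ => k * t + l := by fun_prop
  have hvol : Measure.map (fun t => k * t + l) volume = ENNReal.ofReal k⁻¹ • volume := by
    have : (fun t => k * t + l) = (fun t => t + l) ∘ (fun t => k * t) := rfl
    rw [this, ← Measure.map_map (by fun_prop) (by fun_prop), Real.map_volume_mul_left hk.ne',
      Measure.map_smul, map_add_right_eq_self, abs_of_pos (inv_pos.2 hk)]
  rw [hpre, ← Measure.restrict_map hmeas measurableSet_Ioo, hvol, Measure.restrict_smul]

theorem EdgeL2.memLp_comp_affine {a b c e k l w w' : ℝ} (hk : 0 < k) (hc : k * a + l = c)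
    (he : k * b + l = e) (hw : 0 < w) (hw' : w' = w * k) (f : EdgeL2 d c e w') :
    MemLp (fun t => (k : ℂ) • f (k * t + l)) 2 (edgeMeasure a b w) := by
  refine MemLp.const_smul (f := fun t => f (k * t + l)) ?_ (k : ℂ)
  have hmeas : Measurable fun t : ℝ => k * t + l := by fun_prop
  refine MemLp.comp_of_map (g := f) (f := fun t => k * t + l) ?_ hmeas.aemeasurable
  have hw'0 : 0 < w' := hw' ▸ mul_pos hw hk
  have h2 : edgeMeasure c e w' = ENNReal.ofReal w' • volume.restrict (Ioo c e) := rfl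
  have h3 : Measure.map (fun t => k * t + l) (edgeMeasure a b w)
      = ENNReal.ofReal (w * k⁻¹ * w'⁻¹) • edgeMeasure c e w' := by
    rw [edgeMeasure, edgeMeasure, Measure.map_smul, map_affine_restrict_Ioo hk hc he, smul_smul,
      smul_smul, ← ENNReal.ofReal_mul hw.le, ← ENNReal.ofReal_mul (by positivity)]
    congr 2
    field_simp
  rw [h3]
  exact (Lp.memLp f).smul_measure ENNReal.ofReal_ne_top

/-- The rescaling `f ↦ k f(k · + l)`, which is an isometry from `L²_{w k}` to `L²_w`. -/
noncomputable def edgeAffine {a b c e k l w w' : ℝ} (hab : a ≤ b) (hk : 0 < k)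
    (hc : k * a + l = c) (he : k * b + l = e) (hw : 0 < w) (hw' : w' = w * k) :
    EdgeL2 d c e w' →ₗᵢ[ℂ] EdgeL2 d a b w where
  toFun f := (EdgeL2.memLp_comp_affine hk hc he hw hw' f).toLp _
  map_add' f g := by
    rw [← MemLp.toLp_add]
    refine MemLp.toLp_congr _ _ (ae_edgeMeasure ?_)
    filter_upwards [ae_restrict_Ioo_comp_affine hk hc he (ae_of_ae_edgeMeasure
      (hw' ▸ mul_pos hw hk) (Lp.coeFn_add f g))] with t ht
    rw [ht, Pi.add_apply, smul_add]
    rfl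
  map_smul' z f := by
    rw [RingHom.id_apply, ← MemLp.toLp_const_smul]
    refine MemLp.toLp_congr _ _ (ae_edgeMeasure ?_)
    filter_upwards [ae_restrict_Ioo_comp_affine hk hc he (ae_of_ae_edgeMeasure
      (hw' ▸ mul_pos hw hk) (Lp.coeFn_smul z f))] with t ht
    rw [ht, Pi.smul_apply, smul_comm]
    rfl
  norm_map' f := by
    refine (sq_eq_sq₀ (norm_nonneg _) (norm_nonneg _)).1 ?_
    change ‖(EdgeL2.memLp_comp_affine hk hc he hw hw' f).toLp _‖ ^ 2 = _
    rw [EdgeL2.norm_sq_eq hw, EdgeL2.norm_sq_eq (hw' ▸ mul_pos hw hk)]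
    -- The prefactor contributes k² and the substitution k⁻¹; together with the weight this is w k =
    -- w'.
    have h := setIntegral_Ioo_comp_affine hab hk hc he fun t => k ^ 2 * ‖f t‖ ^ 2
    rw [integral_const_mul _ (fun t => ‖f t‖ ^ 2)] at h
    have e1 : ∫ t in Ioo a b, ‖(EdgeL2.memLp_comp_affine hk hc he hw hw' f).toLp _ t‖ ^ 2
        = ∫ t in Ioo a b, k ^ 2 * ‖f (k * t + l)‖ ^ 2 := by
      refine integral_congr_ae ?_
      filter_upwards [ae_of_ae_edgeMeasure hw
        (MemLp.coeFn_toLp (EdgeL2.memLp_comp_affine hk hc he hw hw' f))] with t ht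
      rw [ht, norm_smul, mul_pow, Complex.norm_real, Real.norm_eq_abs, sq_abs]
    rw [e1, h, smul_eq_mul]
    refine Eq.trans ?_ (congrArg (· * ∫ t in Ioo c e, ‖f t‖ ^ 2) hw').symm
    field_simp

section

variable {a b c e k l w w' : ℝ} (hab : a ≤ b) (hk : 0 < k)
  (hc : k * a + l = c) (he : k * b + l = e) (hw : 0 < w) (hw' : w' = w * k)

theorem coeFn_edgeAffine (f : EdgeL2 d c e w') :
    edgeAffine hab hk hc he hw hw' f =ᵐ[volume.restrict (Ioo a b)]
      fun t => (k : ℂ) • f (k * t + l) :=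
  ae_of_ae_edgeMeasure hw (MemLp.coeFn_toLp (EdgeL2.memLp_comp_affine hk hc he hw hw' f))

/-- The two weight relations force k'k = 1, and the endpoint relations then make the affine maps
inverse to each other. -/
theorem edgeAffine_edgeAffine {k' l' : ℝ} (hce : c ≤ e) (hk' : 0 < k') (ha : k' * c + l' = a)
    (hb : k' * e + l' = b) (hw'0 : 0 < w') (hw₂ : w = w' * k') (f : EdgeL2 d c e w') :
    edgeAffine hce hk' ha hb hw'0 hw₂ (edgeAffine hab hk hc he hw hw' f) = f := by
  have hkk : k' * k = 1 := by
    rw [hw', mul_assoc] at hw₂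
    have := mul_left_cancel₀ hw.ne' ((mul_one w).trans hw₂)
    linarith
  refine EdgeL2.ext_ae ?_
  filter_upwards [coeFn_edgeAffine hce hk' ha hb hw'0 hw₂ (edgeAffine hab hk hc he hw hw' f),
    ae_restrict_Ioo_comp_affine hk' ha hb (coeFn_edgeAffine hab hk hc he hw hw' f)] with t h1 h2
  have ht : k * (k' * t + l') + l = t := by
    have : k * l' + l = 0 := by
      have h3 : k * (k' * c + l') + l = c := by rw [ha, hc]
      linear_combination h3 - c * hkk
    linear_combination this + t * hkk
  rw [h1, h2, smul_smul, ← Complex.ofReal_mul, hkk, ht, Complex.ofReal_one, one_smul]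

/-- The weighted functions, which alone enter the boundary conditions and the derivative, are
transported by pure substitution. The chain rule then yields the factor k that `edgeAffine` puts on
the derivative, so the operators are intertwined. -/
theorem coeFn_smul_edgeAffine (f : EdgeL2 d c e w') :
    (fun t => (w : ℂ) • edgeAffine hab hk hc he hw hw' f t) =ᵐ[volume.restrict (Ioo a b)]
      fun t => (w' : ℂ) • f (k * t + l) := by
  filter_upwards [coeFn_edgeAffine hab hk hc he hw hw' f] with t ht
  rw [ht, smul_smul, ← Complex.ofReal_mul, ← hw']

end

section

variable {E : Type*} {P₁ : Matrix (Fin d) (Fin d) ℂ} {a b c e k l : E → ℝ}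
  {w w' : E → {r : ℝ // 0 < r}} (hab : ∀ i, a i ≤ b i) (hk : ∀ i, 0 < k i)
  (hc : ∀ i, k i * a i + l i = c i) (he : ∀ i, k i * b i + l i = e i)
  (hw' : ∀ i, (w' i : ℝ) = w i * k i)

/-- The rescaling of all edges. -/
noncomputable def netAffine :
    NetL2 d c e (fun i => (w' i : ℝ)) →ₗᵢ[ℂ] NetL2 d a b (fun i => (w i : ℝ)) :=
  lpMapIsometry fun i => edgeAffine (hab i) (hk i) (hc i) (he i) (w i).2 (hw' i)

theorem netAffine_mem_netGraph {p : NetL2 d c e (fun i => (w' i : ℝ)) ×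
    NetL2 d c e (fun i => (w' i : ℝ))} (hp : p ∈ netGraph P₁ c e w') :
    (netAffine hab hk hc he hw' p.1, netAffine hab hk hc he hw' p.2) ∈ netGraph P₁ a b w := by
  obtain ⟨z, hz⟩ := hp
  refine ⟨netAffine hab hk hc he hw' z, fun i => ?_⟩
  obtain ⟨h1, h2, h3⟩ := hz i
  have hf := coeFn_smul_edgeAffine (hab i) (hk i) (hc i) (he i) (w i).2 (hw' i) (p.1 i)
  have hcoe := coeFn_edgeAffine (d := d) (hab i) (hk i) (hc i) (he i) (w i).2 (hw' i)
  refine ⟨(h1.comp_affine (hab i) (hk i) (hc i) (he i)).congr hf (hcoe (z i)),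
    (h2.comp_affine (hk i) (hc i) (he i)).congr hf, ?_⟩
  filter_upwards [hcoe (p.2 i), hcoe (z i),
    ae_restrict_Ioo_comp_affine (hk i) (hc i) (he i) h3] with t q1 q2 q3
  refine q1.trans ?_
  refine Eq.trans ?_ (congrArg (Matrix.toEuclideanLin P₁) q2).symm
  rw [q3, map_smul]

end

variable {E : Type*} (a b : E → ℝ) (hab : ∀ e, a e < b e)

/-- The map `g ↦ (α_e⁻¹ g_e((· - a e) / α_e))_e`. -/
noncomputable def netScale :
    NetL2 d (fun _ : E => 0) (fun _ => 1) (fun e => (invLength a b hab e : ℝ)) →ₗᵢ[ℂ]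
      NetL2 d a b (fun e => (unitWeight E e : ℝ)) :=
  netAffine (k := fun e => 1 / (b e - a e)) (l := fun e => -a e / (b e - a e))
    (fun e => (hab e).le) (fun e => one_div_pos.2 (sub_pos.2 (hab e))) (fun e => by ring)
    (fun e => by have := (sub_pos.2 (hab e)).ne'; field_simp; ring) (fun e => (one_mul _).symm)

/-- The map `f ↦ (α_e f_e(α_e · + a e))_e`. -/
noncomputable def netScaleInv :
    NetL2 d a b (fun e => (unitWeight E e : ℝ)) →ₗᵢ[ℂ]
      NetL2 d (fun _ : E => 0) (fun _ => 1) (fun e => (invLength a b hab e : ℝ)) :=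
  netAffine (k := fun e => b e - a e) (l := a) (fun _ => zero_le_one)
    (fun e => sub_pos.2 (hab e)) (fun e => by ring) (fun e => by ring)
    (fun e => (one_div_mul_cancel (sub_pos.2 (hab e)).ne').symm)

theorem netScale_netScaleInv (x : NetL2 d a b (fun e => (unitWeight E e : ℝ))) :
    netScale a b hab (netScaleInv a b hab x) = x := by
  ext1
  funext e
  exact edgeAffine_edgeAffine _ _ _ _ _ _ _ _ _ _ _ _ (x e)

/-- The unitary map `g ↦ (α_e⁻¹ g_e((· - a e) / α_e))_e`. -/
noncomputable def netRescale :
    NetL2 d (fun _ : E => 0) (fun _ => 1) (fun e => (invLength a b hab e : ℝ)) ≃ₗᵢ[ℂ]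
      NetL2 d a b (fun e => (unitWeight E e : ℝ)) :=
  LinearIsometryEquiv.ofSurjective (netScale a b hab) fun x =>
    ⟨netScaleInv a b hab x, netScale_netScaleInv a b hab x⟩

theorem netRescale_symm_apply (x : NetL2 d a b (fun e => (unitWeight E e : ℝ))) :
    (netRescale a b hab).symm x = netScaleInv a b hab x :=
  (netRescale a b hab).symm_apply_eq.2 (netScale_netScaleInv a b hab x).symm

theorem netRescale_mem_netGraph {P₁ : Matrix (Fin d) (Fin d) ℂ}
    {p : NetL2 d (fun _ : E => 0) (fun _ => 1) (fun e => (invLength a b hab e : ℝ)) ×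
      NetL2 d (fun _ : E => 0) (fun _ => 1) (fun e => (invLength a b hab e : ℝ))}
    (hp : p ∈ netGraph P₁ (fun _ : E => 0) (fun _ => 1) (invLength a b hab)) :
    (netRescale a b hab p.1, netRescale a b hab p.2) ∈ netGraph P₁ a b (unitWeight E) :=
  netAffine_mem_netGraph (w := unitWeight E) (w' := invLength a b hab) _ _ _ _ _ hp

theorem netRescale_symm_mem_netGraph {P₁ : Matrix (Fin d) (Fin d) ℂ}
    {p : NetL2 d a b (fun e => (unitWeight E e : ℝ)) ×
      NetL2 d a b (fun e => (unitWeight E e : ℝ))}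
    (hp : p ∈ netGraph P₁ a b (unitWeight E)) :
    ((netRescale a b hab).symm p.1, (netRescale a b hab).symm p.2)
      ∈ netGraph P₁ (fun _ : E => 0) (fun _ => 1) (invLength a b hab) := by
  rw [netRescale_symm_apply, netRescale_symm_apply]
  exact netAffine_mem_netGraph (w' := unitWeight E) (w := invLength a b hab) _ _ _ _ _ hp

theorem coeFn_netRescale
    (g : NetL2 d (fun _ : E => 0) (fun _ => 1) (fun e => (invLength a b hab e : ℝ))) (e : E) :
    netRescale a b hab g e =ᵐ[volume.restrict (Ioo (a e) (b e))]
      fun s => ((1 / (b e - a e) : ℝ) : ℂ) • g e ((s - a e) / (b e - a e)) := by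
  have hα : 0 < b e - a e := sub_pos.2 (hab e)
  have h := coeFn_edgeAffine (d := d) (a := a e) (b := b e) (c := 0) (e := 1)
    (k := 1 / (b e - a e)) (l := -a e / (b e - a e)) (w := unitWeight E e)
    (w' := invLength a b hab e) (hab e).le (one_div_pos.2 hα) (by ring) (by field_simp; ring)
    (unitWeight E e).2 (one_mul _).symm (g e)
  filter_upwards [h] with t ht
  refine ht.trans ?_
  congr 2
  ring

end Rescaling

/-! ### Deficiency spaces of the network and their rescaling -/

section DeficiencySpaces

variable {d : ℕ} {E : Type*} {P₁ S : Matrix (Fin d) (Fin d) ℂ} {m : Fin d → ℝ}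
  {w : E → {r : ℝ // 0 < r}}

theorem mem_kerOneSubAdjoint_netOp_iff (hP : P₁.IsHermitian) (hPu : IsUnit P₁)
    (x : NetL2 d (fun _ : E => 0) (fun _ => 1) (fun e => (w e : ℝ))) :
    x ∈ kerOneSubAdjoint (netOp P₁ (fun _ : E => 0) (fun _ => 1) w) ↔
      ∀ e, MemEdgeKer 1 P₁ (w e) (x e) := by
  rw [mem_kerOneSubAdjoint, mem_adjoint_netOp_graph_iff (fun _ => zero_lt_one) hP]
  refine forall_congr' fun e => ?_
  rw [memEdgeKer_iff (one_pow 2) (w e).2 hPu, Complex.ofReal_one, one_smul]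

theorem mem_kerOneAddAdjoint_netOp_iff (hP : P₁.IsHermitian) (hPu : IsUnit P₁)
    (x : NetL2 d (fun _ : E => 0) (fun _ => 1) (fun e => (w e : ℝ))) :
    x ∈ kerOneAddAdjoint (netOp P₁ (fun _ : E => 0) (fun _ => 1) w) ↔
      ∀ e, MemEdgeKer (-1) P₁ (w e) (x e) := by
  rw [mem_kerOneAddAdjoint, mem_adjoint_netOp_graph_iff (fun _ => zero_lt_one) hP]
  refine forall_congr' fun e => ?_
  rw [memEdgeKer_iff (by norm_num) (w e).2 hPu, Complex.ofReal_neg, Complex.ofReal_one, neg_smul,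
    one_smul]
  rfl

/-- The isometry from `ℓ²(E; ℂᵈ)` given by the exponentials on every edge. -/
noncomputable def netKerIsometry {σ : ℝ} (hσ : σ ^ 2 = 1) (w : E → {r : ℝ // 0 < r})
    (hS : S ∈ Matrix.unitaryGroup (Fin d) ℂ) (hm : ∀ k, m k ≠ 0) :
    lp (fun _ : E => EuclideanSpace ℂ (Fin d)) 2 →ₗᵢ[ℂ]
      NetL2 d (fun _ : E => 0) (fun _ => 1) (fun e => (w e : ℝ)) :=
  lpMapIsometry fun e => edgeKerIsometry hσ (w e).2 hS hm

theorem exists_linearIsometryEquiv_of_range_eq {V X Y : Type*}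
    [NormedAddCommGroup V] [InnerProductSpace ℂ V] [NormedAddCommGroup X] [InnerProductSpace ℂ X]
    [NormedAddCommGroup Y] [InnerProductSpace ℂ Y] (J : V →ₗᵢ[ℂ] X) (J' : V →ₗᵢ[ℂ] Y)
    {K : Submodule ℂ X} {K' : Submodule ℂ Y} (hK : LinearMap.range J.toLinearMap = K)
    (hK' : LinearMap.range J'.toLinearMap = K') :
    ∃ U : K ≃ₗᵢ[ℂ] K', ∀ x : K, ∃ v, (x : X) = J v ∧ (U x : Y) = J' v := by
  subst hK hK'
  refine ⟨J.equivRange.symm.trans J'.equivRange, fun x => ⟨J.equivRange.symm x, ?_, rfl⟩⟩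
  exact congrArg Subtype.val (J.equivRange.apply_symm_apply x).symm

/-- The unitary rescaling of the deficiency spaces. -/
theorem exists_deficiency_rescaling {σ : ℝ} (hσ : σ ^ 2 = 1) {a b : E → ℝ}
    (hab : ∀ e, a e < b e) (hPu : IsUnit P₁) (hS : S ∈ Matrix.unitaryGroup (Fin d) ℂ)
    (hPS : P₁ = Sᴴ * Matrix.diagonal (fun k => (m k : ℂ)) * S)
    {K : Submodule ℂ (NetL2 d (fun _ : E => 0) (fun _ => 1)
      (fun e => (invLength a b hab e : ℝ)))}
    {K' : Submodule ℂ (NetL2 d (fun _ : E => 0) (fun _ => 1) (fun e => (unitWeight E e : ℝ)))}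
    (hK : ∀ x, x ∈ K ↔ ∀ e, MemEdgeKer σ P₁ (invLength a b hab e) (x e))
    (hK' : ∀ x, x ∈ K' ↔ ∀ e, MemEdgeKer σ P₁ (unitWeight E e) (x e)) :
    ∃ U : K ≃ₗᵢ[ℂ] K', ∀ φ e, IsEdgeRescaling σ (b e - a e) P₁ S m (φ.1 e) ((U φ).1 e) := by
  have hm := diag_ne_zero_of_isUnit hPu hPS
  have hr : ∀ (w : E → {r : ℝ // 0 < r}) x,
      x ∈ LinearMap.range (netKerIsometry hσ w hS hm).toLinearMap ↔
        ∀ e, MemEdgeKer σ P₁ (w e) (x e) := fun w x =>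
    mem_range_lpMapIsometry.trans
      (forall_congr' fun e => mem_range_edgeKerIsometry hσ (w e).2 hPu hS hm hPS (x e))
  -- Both deficiency spaces are ranges of isometries from the same space ℓ²(E; ℂᵈ); U keeps the
  -- coordinates and changes the exponentials.
  obtain ⟨U, hU⟩ := exists_linearIsometryEquiv_of_range_eq
    (netKerIsometry hσ (invLength a b hab) hS hm) (netKerIsometry hσ (unitWeight E) hS hm)
    (K := K) (K' := K') (by ext x; rw [hr, hK]) (by ext x; rw [hr, hK'])
  refine ⟨U, fun φ e => ?_⟩
  obtain ⟨v, h1, h2⟩ := hU φ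
  rw [h1, h2]
  exact isEdgeRescaling_edgeSol hσ (sub_pos.2 (hab e)) hS hm hPS (v e)

end DeficiencySpaces

end PHNetwork

/-! ### The main theorem -/

theorem theorem6p8 {E : Type*} [Countable E] (a b : E → ℝ) (hab : ∀ e, a e < b e)
    {d : ℕ} (P₁ S : Matrix (Fin d) (Fin d) ℂ) (m : Fin d → ℝ)
    (hP : P₁.IsHermitian) (hPu : IsUnit P₁) (hS : S ∈ Matrix.unitaryGroup (Fin d) ℂ)
    (hPS : P₁ = Sᴴ * Matrix.diagonal (fun k => (m k : ℂ)) * S) :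
    -- the deficiency spaces of the model operators, edge by edge
    (∀ x, x ∈ PHNetwork.kerOneSubAdjoint (PHNetwork.unitOp E P₁) ↔ ∀ e, PHNetwork.MemEdgeKer 1 P₁ 1 (x e)) ∧
    (∀ x, x ∈ PHNetwork.kerOneAddAdjoint (PHNetwork.unitOp E P₁) ↔ ∀ e, PHNetwork.MemEdgeKer (-1) P₁ 1 (x e)) ∧
    (∀ x, x ∈ PHNetwork.kerOneSubAdjoint (PHNetwork.scaledOp P₁ a b hab) ↔
      ∀ e, PHNetwork.MemEdgeKer 1 P₁ (1 / (b e - a e)) (x e)) ∧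
    (∀ x, x ∈ PHNetwork.kerOneAddAdjoint (PHNetwork.scaledOp P₁ a b hab) ↔
      ∀ e, PHNetwork.MemEdgeKer (-1) P₁ (1 / (b e - a e)) (x e)) ∧
    -- the unitary rescalings and the canonical boundary system, each given by its formula
    ∃ (Sab : PHNetwork.NetL2 d (fun _ : E => 0) (fun _ => 1)
          (fun e => (PHNetwork.invLength a b hab e : ℝ)) ≃ₗᵢ[ℂ]
        PHNetwork.NetL2 d a b (fun e => (PHNetwork.unitWeight E e : ℝ)))
      (Sp : PHNetwork.kerOneSubAdjoint (PHNetwork.scaledOp P₁ a b hab) ≃ₗᵢ[ℂ]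
        PHNetwork.kerOneSubAdjoint (PHNetwork.unitOp E P₁))
      (Sm : PHNetwork.kerOneAddAdjoint (PHNetwork.scaledOp P₁ a b hab) ≃ₗᵢ[ℂ]
        PHNetwork.kerOneAddAdjoint (PHNetwork.unitOp E P₁))
      (F : (PHNetwork.scaledOp P₁ a b hab).adjoint.domain →ₗ[ℂ]
        PHNetwork.kerOneSubAdjoint (PHNetwork.scaledOp P₁ a b hab) ×
          PHNetwork.kerOneAddAdjoint (PHNetwork.scaledOp P₁ a b hab))
      (hdom : ∀ x ∈ (PHNetwork.arbOp P₁ a b).adjoint.domain,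
        Sab.symm x ∈ (PHNetwork.scaledOp P₁ a b hab).adjoint.domain),
      (∀ g e, Sab g e =ᵐ[volume.restrict (Ioo (a e) (b e))]
        fun s => ((1 / (b e - a e) : ℝ) : ℂ) • g e ((s - a e) / (b e - a e))) ∧
      (∀ φ e, PHNetwork.IsEdgeRescaling 1 (b e - a e) P₁ S m (φ.1 e) ((Sp φ).1 e)) ∧
      (∀ φ e, PHNetwork.IsEdgeRescaling (-1) (b e - a e) P₁ S m (φ.1 e) ((Sm φ).1 e)) ∧
      PHNetwork.IsCanonicalBoundaryMap (PHNetwork.scaledOp P₁ a b hab) F ∧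
      PHNetwork.IsBoundarySystem (PHNetwork.scaledOp P₁ a b hab) F ∧
      ∀ H, PHNetwork.arbOp P₁ a b ≤ H → H ≤ -(PHNetwork.arbOp P₁ a b).adjoint →
        (PHNetwork.IsMaximalDissipative H ↔
          ∃ T : PHNetwork.kerOneSubAdjoint (PHNetwork.unitOp E P₁) →L[ℂ]
              PHNetwork.kerOneAddAdjoint (PHNetwork.unitOp E P₁), ‖T‖ ≤ 1 ∧
            ∀ x, x ∈ H.domain ↔ ∃ hx : x ∈ (PHNetwork.arbOp P₁ a b).adjoint.domain,
              T (Sp (F ⟨Sab.symm x, hdom x hx⟩).1) = Sm (F ⟨Sab.symm x, hdom x hx⟩).2) ∧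
        (PHNetwork.IsMaximalDissipative (-H) ↔
          ∃ T : PHNetwork.kerOneAddAdjoint (PHNetwork.unitOp E P₁) →L[ℂ]
              PHNetwork.kerOneSubAdjoint (PHNetwork.unitOp E P₁), ‖T‖ ≤ 1 ∧
            ∀ x, x ∈ H.domain ↔ ∃ hx : x ∈ (PHNetwork.arbOp P₁ a b).adjoint.domain,
              T (Sm (F ⟨Sab.symm x, hdom x hx⟩).2) = Sp (F ⟨Sab.symm x, hdom x hx⟩).1) := by
  have h₁ : ∀ (w : E → {r : ℝ // 0 < r}) x, _ :=
    fun w x => PHNetwork.mem_kerOneSubAdjoint_netOp_iff (w := w) hP hPu x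
  have h₂ : ∀ (w : E → {r : ℝ // 0 < r}) x, _ :=
    fun w x => PHNetwork.mem_kerOneAddAdjoint_netOp_iff (w := w) hP hPu x
  refine ⟨h₁ (PHNetwork.unitWeight E), h₂ (PHNetwork.unitWeight E),
    h₁ (PHNetwork.invLength a b hab), h₂ (PHNetwork.invLength a b hab), ?_⟩
  obtain ⟨Sp, hSp⟩ := PHNetwork.exists_deficiency_rescaling (σ := 1) (by norm_num) hab hPu hS hPS
    (h₁ (PHNetwork.invLength a b hab)) (h₁ (PHNetwork.unitWeight E))
  obtain ⟨Sm, hSm⟩ := PHNetwork.exists_deficiency_rescaling (σ := -1) (by norm_num) hab hPu hS hPS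
    (h₂ (PHNetwork.invLength a b hab)) (h₂ (PHNetwork.unitWeight E))
  have hdA : Dense ((PHNetwork.arbOp P₁ a b).domain :
      Set (PHNetwork.NetL2 d a b fun e => (PHNetwork.unitWeight E e : ℝ))) := PHNetwork.dense_netOp_domain
  have hdB : Dense ((PHNetwork.scaledOp P₁ a b hab).domain :
      Set (PHNetwork.NetL2 d (fun _ : E => 0) (fun _ => 1)
        fun e => (PHNetwork.invLength a b hab e : ℝ))) :=
    PHNetwork.dense_netOp_domain
  have h01 : ∀ _ : E, (0 : ℝ) < 1 := fun _ => zero_lt_one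
  obtain ⟨F, hF, hFb⟩ := (PHNetwork.isSkewSymmetric_netOp (w := PHNetwork.invLength a b hab) h01
    hP hPu).exists_canonicalBoundaryMap hdB (PHNetwork.isClosed_netOp h01 hP hPu)
  let U := PHNetwork.netRescale (d := d) a b hab
  -- Since U maps the graph of each minimal operator into that of the other, in both directions, the
  -- adjoints are unitarily equivalent as well.
  have hadj : ∀ {y v}, (y, v) ∈ (PHNetwork.arbOp P₁ a b).adjoint.graph →
      (U.symm y, U.symm v) ∈ (PHNetwork.scaledOp P₁ a b hab).adjoint.graph :=
    fun h => PHNetwork.symm_mem_adjoint_graph hdB hdA U (fun p hp => by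
      rw [PHNetwork.netOp_graph] at hp ⊢
      exact PHNetwork.netRescale_mem_netGraph a b hab hp) h
  have hadj' : ∀ {y v}, (y, v) ∈ (PHNetwork.scaledOp P₁ a b hab).adjoint.graph →
      (U y, U v) ∈ (PHNetwork.arbOp P₁ a b).adjoint.graph :=
    fun h => PHNetwork.symm_mem_adjoint_graph hdA hdB U.symm (fun p hp => by
      rw [PHNetwork.netOp_graph] at hp ⊢
      exact PHNetwork.netRescale_symm_mem_netGraph a b hab hp) h
  have hdom : ∀ x ∈ (PHNetwork.arbOp P₁ a b).adjoint.domain,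
      U.symm x ∈ (PHNetwork.scaledOp P₁ a b hab).adjoint.domain := fun x hx =>
    LinearPMap.mem_domain_of_mem_graph (hadj (LinearPMap.mem_graph _ ⟨x, hx⟩))
  refine ⟨U, Sp, Sm, F, hdom, PHNetwork.coeFn_netRescale a b hab, hSp, hSm, hF, hFb,
    fun H hAH hHA => ?_⟩
  let R : (PHNetwork.arbOp P₁ a b).adjoint.domain →ₗ[ℂ]
      (PHNetwork.scaledOp P₁ a b hab).adjoint.domain :=
    (U.symm.toLinearEquiv.toLinearMap).restrict hdom
  have : CompleteSpace (PHNetwork.kerOneSubAdjoint (PHNetwork.unitOp E P₁)) :=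
    (PHNetwork.isClosed_kerOneSubAdjoint PHNetwork.dense_netOp_domain).completeSpace_coe
  have : CompleteSpace (PHNetwork.kerOneAddAdjoint (PHNetwork.unitOp E P₁)) :=
    (PHNetwork.isClosed_kerOneAddAdjoint PHNetwork.dense_netOp_domain).completeSpace_coe
  -- The boundary maps for A⋆ are those of the weighted operator, preceded by the inverse of U and
  -- followed by S₊ and S₋. Unitarity of these maps preserves both surjectivity and the form
  -- identity.
  refine PHNetwork.isMaximalDissipative_iff_of_boundaryMaps hdA
    (Sp.toLinearEquiv.toLinearMap.comp ((LinearMap.fst ℂ _ _).comp (F.comp R)))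
    (Sm.toLinearEquiv.toLinearMap.comp ((LinearMap.snd ℂ _ _).comp (F.comp R))) ?_ ?_ hAH hHA
  · intro g₁ g₂
    obtain ⟨ξ, hξ⟩ := hFb.1 (Sp.symm g₁, Sm.symm g₂)
    have hU : (U ξ : _) ∈ (PHNetwork.arbOp P₁ a b).adjoint.domain :=
      LinearPMap.mem_domain_of_mem_graph (hadj' (LinearPMap.mem_graph _ ξ))
    have hR : R ⟨U ξ, hU⟩ = ξ := Subtype.ext (U.symm_apply_apply ξ)
    refine ⟨⟨U ξ, hU⟩, ?_, ?_⟩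
    · change Sp (F (R ⟨U ξ, hU⟩)).1 = g₁
      rw [hR, hξ, Sp.apply_symm_apply]
    · change Sm (F (R ⟨U ξ, hU⟩)).2 = g₂
      rw [hR, hξ, Sm.apply_symm_apply]
  · intro x
    have hx : (PHNetwork.scaledOp P₁ a b hab).adjoint (R x)
        = U.symm ((PHNetwork.arbOp P₁ a b).adjoint x) :=
      LinearPMap.mem_graph_snd_inj _ (LinearPMap.mem_graph _ (R x))
        (hadj (LinearPMap.mem_graph _ x)) rfl
    -- On the diagonal the boundary form is 2 Re⟨A⋆x, x⟩.
    have hform := congrArg Complex.re (hFb.2 (R x) (R x))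
    have hsymm := inner_re_symm (𝕜 := ℂ) ((R x : _) : PHNetwork.NetL2 d (fun _ : E => 0)
      (fun _ => 1) (fun e => (PHNetwork.invLength a b hab e : ℝ)))
      ((PHNetwork.scaledOp P₁ a b hab).adjoint (R x))
    have hin : inner ℂ ((PHNetwork.scaledOp P₁ a b hab).adjoint (R x)) (R x : _)
        = inner ℂ ((PHNetwork.arbOp P₁ a b).adjoint x) (x : _) := by
      rw [hx]
      exact U.symm.inner_map_map _ _
    have hn₁ := inner_self_eq_norm_sq (𝕜 := ℂ) (F (R x)).1
    have hn₂ := inner_self_eq_norm_sq (𝕜 := ℂ) (F (R x)).2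
    simp only [RCLike.re_to_complex] at hsymm hn₁ hn₂
    rw [Complex.add_re, Complex.sub_re, hn₁, hn₂, hsymm, hin] at hform
    change _ = ‖Sp (F (R x)).1‖ ^ 2 - ‖Sm (F (R x)).2‖ ^ 2
    rw [Sp.norm_map, Sm.norm_map, ← hform, two_mul]
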